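/- Let $n\ge 2$, let $m>1$ be real, and let $|\cdot|$ be the Euclidean norm on $\mathbb C^n$. For a bounded domain $\Omega\subset\mathbb C^n$, $z\in\Omega$ and $0\ne v\in\mathbb C^n$ put $$\delta_\Omega(z)=\inf_{\xi\in\partial\Omega}|z-\xi|,\qquad \delta_\Omega(z;v)=\inf\{|z-\xi|:\xi\in\partial\Omega\cap(z+\mathbb Cv)\}.$$ A bounded convex domain $\Omega$ is called $m$-convex if there is $C>0$ with $\delta_\Omega(z;v)\le C\,\delta_\Omega(z)^{1/m}$ for all $z\in\Omega$ and $0\neq v\in\mathbb C^n$. The boundary of $\Omega$ is Dini-smooth if it is $C^1$ and every $p\in\partial\Omega$ has a neighbourhood $U$ such that $\int_0^1\frac{\omega(t)}{t}\,dt<\infty$, where $\omega(t)=\sup\{|\vec n(x)-\vec n(y)|: x,y\in\partial\Omega\cap U,\ |x-y|<t\}$ and $\vec n$ is the outer unit normal. The Kobayashi metric is $$K_\Omega(x;v)=\inf\{|\xi|:\ \xi\in\mathbb C,\ \varphi:\mathbb D\to\Omega \text{ holomorphic},\ \varphi(0)=x,\ \xi\,\varphi'(0)=v\},$$ and the Kobayashi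 distance $d_{K_\Omega}(x,y)$ is the infimum of $\int_0^1K_\Omega(\gamma(t);\dot\gamma(t))\,dt$ over all piecewise $C^1$ curves $\gamma:[0,1]\to\Omega$ from $x$ to $y$. Theorem. Let $\Omega_1,\Omega_2\subset\mathbb C^n$ be bounded $m$-convex domains with Dini-smooth boundary, and let $f:\Omega_1\to\Omega_2$ be an isometry for the Kobayashi distances, i.e. $d_{K_{\Omega_2}}(f(x),f(y))=d_{K_{\Omega_1}}(x,y)$ for all $x,y\in\Omega_1$. Then $f$ extends to a homeomorphism $\bar f:\overline{\Omega}_1\to\overline{\Omega}_2$ of the Euclidean closures which restricts to a bijection $\partial\Omega_1\to\partial\Omega_2$, and this boundary map is bi-Hölder in the Euclidean metric with exponents $m$ and $1/m$: there is a constant $\Lambda\ge1$ such that $$\Lambda^{-1}|a-b|^{m}\le|\bar f(a)-\bar f(b)|\le\Lambda|a-b|^{1/m}\qquad\text{for all }a,b\in\partial\Omega_1 .$$ -/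

import Mathlib

open scoped ENNReal

/-- Complex Euclidean space `ℂⁿ` with its Euclidean norm. -/
abbrev Cn (n : ℕ) : Type := EuclideanSpace ℂ (Fin n)

/-- `δ_Ω(z)`: the Euclidean distance from `z` to the boundary of `Ω`. -/
noncomputable def bdryDist {n : ℕ} (Ω : Set (Cn n)) (z : Cn n) : ℝ :=
  Metric.infDist z (frontier Ω)

/-- `δ_Ω(z; v)`: the Euclidean distance from `z` to the part of the boundary of `Ω` lying on
the complex line `z + ℂ v`. (For `Ω` bounded, `z ∈ Ω` and `v ≠ 0` this part is nonempty.) -/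
noncomputable def bdryDistDir {n : ℕ} (Ω : Set (Cn n)) (z v : Cn n) : ℝ :=
  Metric.infDist z (frontier Ω ∩ Set.range fun c : ℂ => z + c • v)

/-- `Ω` is a bounded `m`-convex domain: a bounded convex domain for which, with some `C > 0`,
`δ_Ω(z; v) ≤ C δ_Ω(z)^(1/m)` for all `z ∈ Ω` and all directions `v`; here `m > 1`. -/
structure IsMConvexDomain {n : ℕ} (m : ℝ) (Ω : Set (Cn n)) : Prop where
  isOpen : IsOpen Ω
  nonempty : Ω.Nonempty
  isBounded : Bornology.IsBounded Ω
  convex : Convex ℝ Ω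
  one_lt : 1 < m
  exists_bound : ∃ C : ℝ, 0 < C ∧
    ∀ z ∈ Ω, ∀ v : Cn n, v ≠ 0 → bdryDistDir Ω z v ≤ C * bdryDist Ω z ^ (1 / m)

/-- The real gradient `∇r = (∂r/∂x_j + i ∂r/∂y_j)_j` of a real function `r` on `ℂⁿ = ℝ²ⁿ`,
where `z_j = x_j + i y_j`. -/
noncomputable def realGradient {n : ℕ} (r : Cn n → ℝ) (x : Cn n) : Cn n :=
  WithLp.toLp 2 fun j : Fin n =>
    ((fderiv ℝ r x (EuclideanSpace.single j 1) : ℝ) : ℂ) +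
      Complex.I * ((fderiv ℝ r x (EuclideanSpace.single j Complex.I) : ℝ) : ℂ)

/-- The unit vector `∇r / |∇r|`; it is the outer unit normal to `∂Ω` when `r` is a local
defining function of `Ω = {r < 0}`. -/
noncomputable def unitNormal {n : ℕ} (r : Cn n → ℝ) (x : Cn n) : Cn n :=
  (‖realGradient r x‖⁻¹ : ℝ) • realGradient r x

/-- `r` is a `C¹` defining function of `Ω` on the open set `U`. -/
structure IsC1DefiningFunction {n : ℕ} (Ω U : Set (Cn n)) (r : Cn n → ℝ) : Prop where
  contDiffOn : ContDiffOn ℝ 1 r U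
  fderiv_ne_zero : ∀ x ∈ U, fderiv ℝ r x ≠ 0
  inter_eq : Ω ∩ U = {x ∈ U | r x < 0}

/-- The modulus of continuity `ω(N, S, t) = sup {|N x - N y| : |x - y| < t, x, y ∈ S}`. -/
noncomputable def modulusOfContinuity {n : ℕ} (N : Cn n → Cn n) (S : Set (Cn n)) (t : ℝ) :
    ℝ≥0∞ :=
  ⨆ (x ∈ S) (y ∈ S) (_ : dist x y < t), edist (N x) (N y)

/-- `p` is a Dini-smooth boundary point of `Ω`: the boundary is `C¹` near `p` and the modulus
of continuity `ω` of its outer unit normal near `p` satisfies `∫₀¹ ω(t)/t dt < ∞`. -/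
def IsDiniSmoothAt {n : ℕ} (Ω : Set (Cn n)) (p : Cn n) : Prop :=
  ∃ (U : Set (Cn n)) (r : Cn n → ℝ), IsOpen U ∧ p ∈ U ∧ IsC1DefiningFunction Ω U r ∧
    ∫⁻ t in Set.Ioc (0 : ℝ) 1,
      modulusOfContinuity (unitNormal r) (frontier Ω ∩ U) t / ENNReal.ofReal t < ∞

/-- Every boundary point of `Ω` is Dini-smooth. -/
def HasDiniSmoothBoundary {n : ℕ} (Ω : Set (Cn n)) : Prop :=
  ∀ p ∈ frontier Ω, IsDiniSmoothAt Ω p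

/-- The infinitesimal Kobayashi metric
`K_Ω(x; v) = inf {|ξ| : φ ∈ Hol(𝔻, Ω), φ(0) = x, φ'(0) ξ = v}`. -/
noncomputable def kobayashiMetric {n : ℕ} (Ω : Set (Cn n)) (x v : Cn n) : ℝ≥0∞ :=
  ⨅ (φ : ℂ → Cn n) (ξ : ℂ) (_ : DifferentiableOn ℂ φ (Metric.ball 0 1))
    (_ : Set.MapsTo φ (Metric.ball 0 1) Ω) (_ : φ 0 = x) (_ : ξ • deriv φ 0 = v), ‖ξ‖ₑ

/-- `γ` restricts to a piecewise `C¹` curve on `[0, 1]`: it is `C¹` on each closed piece of a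
finite subdivision (so in particular continuous on `[0, 1]`). -/
def IsPiecewiseC1 {n : ℕ} (γ : ℝ → Cn n) : Prop :=
  ∃ (N : ℕ) (t : ℕ → ℝ), Monotone t ∧ t 0 = 0 ∧ t N = 1 ∧
    ∀ i < N, ContDiffOn ℝ 1 γ (Set.Icc (t i) (t (i + 1)))

/-- The Kobayashi length `∫₀¹ K_Ω(γ(t); γ'(t)) dt` of a curve. -/
noncomputable def kobayashiLength {n : ℕ} (Ω : Set (Cn n)) (γ : ℝ → Cn n) : ℝ≥0∞ :=
  ∫⁻ t in Set.Icc (0 : ℝ) 1, kobayashiMetric Ω (γ t) (deriv γ t)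

/-- The Kobayashi distance: the infimum of the Kobayashi lengths of the piecewise `C¹` curves
in `Ω` from `x` to `y`. -/
noncomputable def kobayashiDist {n : ℕ} (Ω : Set (Cn n)) (x y : Cn n) : ℝ≥0∞ :=
  ⨅ (γ : ℝ → Cn n) (_ : IsPiecewiseC1 γ) (_ : Set.MapsTo γ (Set.Icc 0 1) Ω)
    (_ : γ 0 = x) (_ : γ 1 = y), kobayashiLength Ω γ

/-- `f` preserves the Kobayashi distances (surjectivity is not required). -/
def IsKobayashiIsometry {n : ℕ} {Ω₁ Ω₂ : Set (Cn n)} (f : Ω₁ → Ω₂) : Prop :=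
  ∀ x y : Ω₁, kobayashiDist Ω₂ (f x) (f y) = kobayashiDist Ω₁ x y

/-- `g` is `α`-bi-Hölder: a bijection with
`Λ⁻¹ d(x, y)^(1/α) ≤ d(g x, g y) ≤ Λ d(x, y)^α` for some `Λ ≥ 1`, where `0 < α < 1`. -/
def IsBiHolder {X Y : Type*} [MetricSpace X] [MetricSpace Y] (α : ℝ) (g : X → Y) : Prop :=
  0 < α ∧ α < 1 ∧ Function.Bijective g ∧ ∃ Λ : ℝ, 1 ≤ Λ ∧ ∀ x y : X,
    Λ⁻¹ * dist x y ^ (1 / α) ≤ dist (g x) (g y) ∧ dist (g x) (g y) ≤ Λ * dist x y ^ α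

/-! Everything rests on two-sided estimates of the Kobayashi distance by Euclidean data. Write δ for
the distance to the boundary. Up to additive constants, m log|x - y| - ½ log δ(x) - ½ log δ(y) ≤
d(x, y) ≤ log(|x - y| + δ(x) + δ(y)) - ½ log δ(x) - ½ log δ(y).

The lower bound (`exists_le_kobayashiDist`) uses `m`-convexity. A supporting half space at a nearby
boundary point bounds the metric below by a multiple of |v| / δ^(1/m), and a supporting half space
at a nearest boundary point makes ½ log δ cost at least its own increase. A curve from `x` to `y`
must pay for leaving both ends.

The upper bound (`exists_kobayashiDist_le`) uses Dini smoothness. At height `t` above a boundary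
point, a disc in the normal complex line bounds the metric by (1 + error) / (2t). The errors over
successive scales are summable exactly because of the Dini condition, so rising from depth δ to
height `s` costs ½ log(s / δ) + O(1). Both points are raised to height |x - y| + δ(x) + δ(y), where
joining them has bounded cost.

An isometry preserves d. Comparison with a base point shows that the depths of `x` and `f x` are
comparable (`exists_bdryDist_le_mul_bdryDist`). The logarithmic depth terms then cancel between the
two estimates, leaving |f x - f y|^m ≤ C (|x - y| + δ(x) + δ(y)), and the same with the roles
exchanged (`exists_norm_sub_rpow_le`). This gives limits at the boundary, and there, where δ = 0,
the two Hölder inequalities.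

Surjectivity is not assumed. The image of `f` is open by invariance of domain and relatively closed
because boundary goes to boundary, so it is the whole connected target. Invariance of domain is
derived here from Brouwer's fixed point theorem. -/

/-! ### Brouwer's fixed point theorem and invariance of domain. -/

section InvarianceOfDomain

open Set Metric MeasureTheory Filter Topology

variable {V : Type*} [NormedAddCommGroup V] [InnerProductSpace ℝ V] [FiniteDimensional ℝ V]

theorem exists_polynomial_det_one_add_smul (A : V →L[ℝ] V) :
    ∃ P : Polynomial ℝ, P.natDegree ≤ Module.finrank ℝ V ∧
      ∀ t : ℝ, P.eval t = (1 + t • A : V →L[ℝ] V).det := by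
  let b := Module.finBasis ℝ V
  let M := LinearMap.toMatrix b b (A : V →ₗ[ℝ] V)
  refine ⟨Matrix.det ((Polynomial.X : Polynomial ℝ) • M.map Polynomial.C +
    (1 : Matrix _ _ ℝ).map Polynomial.C), ?_, fun t => ?_⟩
  · simpa using Polynomial.natDegree_det_X_add_C_le M 1
  · rw [← Polynomial.coe_evalRingHom, RingHom.map_det, ContinuousLinearMap.det,
      ← LinearMap.det_toMatrix b]
    congr 1
    ext i j
    simp [M, Matrix.one_apply, LinearMap.toMatrix_apply, apply_ite, add_comm,
      Finsupp.single_apply, eq_comm]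
    ring

/-- Lagrange interpolation of a polynomial in `t` of degree at most the dimension. The weights do
not depend on `A`, so the identity can be integrated over a family of operators. -/
theorem det_one_add_smul_eq_sum (s : Finset ℝ) (hs : Module.finrank ℝ V < s.card)
    (A : V →L[ℝ] V) (t : ℝ) :
    (1 + t • A : V →L[ℝ] V).det =
      ∑ u ∈ s, (1 + u • A : V →L[ℝ] V).det * (Lagrange.basis s id u).eval t := by
  obtain ⟨P, hP, hPe⟩ := exists_polynomial_det_one_add_smul A
  have hinj : Set.InjOn (id : ℝ → ℝ) s := Set.injOn_id _
  have hdeg : P.degree < s.card :=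
    Polynomial.degree_le_natDegree.trans_lt (by exact_mod_cast hP.trans_lt hs)
  rw [← hPe t, Lagrange.eq_interpolate hinj hdeg, Lagrange.interpolate_apply,
    Polynomial.eval_finsetSum]
  simp [hPe]

/-- The operators `1 + t • A` with `t` in `[0, 1]` are invertible by the Neumann series, so the
determinant cannot change sign on its way from the value 1 at `t = 0`. -/
theorem det_one_add_pos (A : V →L[ℝ] V) (hA : ‖A‖ < 1) : 0 < (1 + A : V →L[ℝ] V).det := by
  have hne : ∀ t ∈ Icc (0 : ℝ) 1, (1 + t • A : V →L[ℝ] V).det ≠ 0 := by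
    intro t ht h0
    have hu : IsUnit (1 - (-(t • A)) : V →L[ℝ] V) := by
      apply isUnit_one_sub_of_norm_lt_one
      rw [norm_neg, norm_smul, Real.norm_of_nonneg ht.1]
      nlinarith [norm_nonneg A, ht.2]
    rw [sub_neg_eq_add] at hu
    have := hu.map (ContinuousLinearMap.toLinearMapRingHom : (V →L[ℝ] V) →+* (V →ₗ[ℝ] V))
    exact ((LinearMap.isUnit_iff_isUnit_det _).1 this).ne_zero h0
  have hc : ContinuousOn (fun t : ℝ => (1 + t • A : V →L[ℝ] V).det) (Icc 0 1) := by
    have : Continuous fun t : ℝ => (1 + t • A : V →L[ℝ] V).det :=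
      ContinuousLinearMap.continuous_det.comp (by fun_prop)
    exact this.continuousOn
  by_contra hneg
  push Not at hneg
  have h1 : (0 : ℝ) ∈ Icc ((1 + (1 : ℝ) • A : V →L[ℝ] V).det)
      ((1 + (0 : ℝ) • A : V →L[ℝ] V).det) := by
    refine ⟨by simpa using hneg, ?_⟩
    simp [ContinuousLinearMap.det]
  obtain ⟨t, ht, h0⟩ := intermediate_value_Icc' zero_le_one hc h1
  exact hne t ht h0

variable [MeasurableSpace V] [BorelSpace V]

/-- There is no `C¹` retraction of a closed ball onto its boundary sphere. -/
theorem not_exists_retraction_sphere {O : Set V} (hO : IsOpen O) (hB : closedBall (0 : V) 1 ⊆ O)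
    {r : V → V} (hr : ContDiffOn ℝ 1 r O) (hr1 : ∀ x ∈ closedBall (0 : V) 1, ‖r x‖ = 1)
    (hfix : ∀ x, ‖x‖ = 1 → r x = x) : False := by
  set h : V → V := fun x => r x - x with hh
  have hcd : ContDiffOn ℝ 1 h O := hr.sub contDiffOn_id
  have hcf : ContinuousOn (fderiv ℝ h) O := hcd.continuousOn_fderiv_of_isOpen hO le_rfl
  have hdiff : ∀ x ∈ O, DifferentiableAt ℝ h x := fun x hx =>
    (hcd.differentiableOn one_ne_zero).differentiableAt (hO.mem_nhds hx)
  have hcompact : IsCompact (closedBall (0 : V) 1) := isCompact_closedBall _ _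
  obtain ⟨K, hK⟩ := hcompact.exists_bound_of_continuousOn (hcf.mono hB)
  have hK0 : 0 ≤ K := (norm_nonneg _).trans (hK 0 (by simp))
  have hLip : ∀ x ∈ closedBall (0 : V) 1, ∀ y ∈ closedBall (0 : V) 1,
      ‖h x - h y‖ ≤ K * ‖x - y‖ := fun x hx y hy =>
    (convex_closedBall (0 : V) 1).norm_image_sub_le_of_norm_fderiv_le
      (fun z hz => hdiff z (hB hz)) hK hy hx
  -- The homotopy from the identity to `r`. The integral of its Jacobian over the ball is polynomial
  -- in `t`; for small `t` it is the volume of the ball, while at `t = 1` it vanishes.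
  set g : ℝ → V → V := fun t x => x + t • h x with hg
  have hgc : ∀ t, ContinuousOn (g t) (closedBall 0 1) := fun t =>
    continuousOn_id.add ((hcd.continuousOn.mono hB).const_smul t)
  have hgd : ∀ t, ∀ x ∈ O, HasFDerivAt (g t) (1 + t • fderiv ℝ h x : V →L[ℝ] V) x :=
    fun t x hx => (hasFDerivAt_id x).add ((hdiff x hx).hasFDerivAt.const_smul t)
  have hball : ball (0 : V) 1 ⊆ closedBall 0 1 := ball_subset_closedBall
  set ε : ℝ := 1 / (K + 1) with hε
  have hεpos : 0 < ε := by positivity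
  have hε1 : ε ≤ 1 := by rw [hε, div_le_one (by positivity)]; linarith
  have hsmall : ∀ t ∈ Ioo 0 ε, t * K < 1 := by
    intro t ht
    have h2 := ht.2
    rw [hε, lt_div_iff₀ (by positivity)] at h2
    nlinarith [ht.1]
  have hinj : ∀ t ∈ Ioo 0 ε, InjOn (g t) (closedBall 0 1) := by
    intro t ht x hx y hy hxy
    have h1 : x - y = -(t • (h x - h y)) := by
      have : x + t • h x = y + t • h y := hxy
      rw [smul_sub, sub_eq_iff_eq_add, neg_sub, sub_add_eq_add_sub, eq_sub_iff_add_eq, this]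
      abel
    have h2 : ‖x - y‖ ≤ t * (K * ‖x - y‖) := by
      conv_lhs => rw [h1, norm_neg, norm_smul, Real.norm_of_nonneg ht.1.le]
      exact mul_le_mul_of_nonneg_left (hLip x hx y hy) ht.1.le
    have h3 : ‖x - y‖ = 0 := by
      nlinarith [norm_nonneg (x - y), hsmall t ht]
    exact sub_eq_zero.1 (norm_eq_zero.1 h3)
  have hnorm : ∀ t ∈ Ioo 0 ε, ∀ x ∈ closedBall (0 : V) 1, ‖t • fderiv ℝ h x‖ < 1 := by
    intro t ht x hx
    rw [norm_smul, Real.norm_of_nonneg ht.1.le]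
    exact (mul_le_mul_of_nonneg_left (hK x hx) ht.1.le).trans_lt (hsmall t ht)
  have hdet : ∀ t ∈ Ioo 0 ε, ∀ x ∈ closedBall (0 : V) 1,
      0 < (1 + t • fderiv ℝ h x : V →L[ℝ] V).det := fun t ht x hx =>
    det_one_add_pos _ (hnorm t ht x hx)
  -- The image is open by the inverse function theorem. A limit point inside the ball comes from the
  -- closed ball by compactness, and not from the sphere, which is fixed pointwise; connectedness of
  -- the ball finishes.
  have himage : ∀ t ∈ Ioo 0 ε, g t '' ball 0 1 = ball 0 1 := by
    intro t ht
    have ht1 : t < 1 := ht.2.trans_le hε1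
    have hsub : g t '' ball 0 1 ⊆ ball 0 1 := by
      rintro _ ⟨x, hx, rfl⟩
      have e : g t x = (1 - t) • x + t • r x := by
        simp only [hg, hh, smul_sub, sub_smul, one_smul]; abel
      rw [mem_ball_zero_iff] at hx ⊢
      rw [e]
      calc _ ≤ ‖(1 - t) • x‖ + ‖t • r x‖ := norm_add_le _ _
        _ = (1 - t) * ‖x‖ + t := by
            rw [norm_smul, norm_smul, hr1 x (by simpa using hx.le),
              Real.norm_of_nonneg ht.1.le, Real.norm_of_nonneg (by linarith)]; ring
        _ < 1 := by nlinarith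
    have hopen : IsOpen (g t '' ball 0 1) := by
      rw [isOpen_iff_mem_nhds]
      rintro _ ⟨x, hx, rfl⟩
      have hxO := hB (hball hx)
      have hst : HasStrictFDerivAt (g t) (1 + t • fderiv ℝ h x : V →L[ℝ] V) x := by
        have : ContDiffAt ℝ 1 (g t) x :=
          contDiffAt_id.add ((hcd.contDiffAt (hO.mem_nhds hxO)).const_smul t)
        have h2 := this.hasStrictFDerivAt one_ne_zero
        rwa [(hgd t x hxO).fderiv] at h2
      have hd : (1 + t • fderiv ℝ h x : V →L[ℝ] V).det ≠ 0 := (hdet t ht x (hball hx)).ne'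
      have hst' : HasStrictFDerivAt (g t) (((1 + t • fderiv ℝ h x :
          V →L[ℝ] V).toContinuousLinearEquivOfDetNeZero hd : V ≃L[ℝ] V) : V →L[ℝ] V) x := by
        rwa [ContinuousLinearMap.coe_toContinuousLinearEquivOfDetNeZero]
      rw [← hst'.map_nhds_eq_of_equiv]
      exact image_mem_map (isOpen_ball.mem_nhds hx)
    refine hsub.antisymm ?_
    have hpre : IsPreconnected (ball (0 : V) 1) := (convex_ball _ _).isPreconnected
    refine hpre.subset_of_closure_inter_subset hopen ?_ ?_
    · exact ⟨g t 0, hsub ⟨0, by simp, rfl⟩, ⟨0, by simp, rfl⟩⟩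
    · rintro y ⟨hy, hy1⟩
      have hcl : closure (g t '' ball 0 1) ⊆ g t '' closedBall 0 1 :=
        closure_minimal (image_mono hball)
          (hcompact.image_of_continuousOn (hgc t)).isClosed
      obtain ⟨x, hx, rfl⟩ := hcl hy
      rcases (mem_closedBall_zero_iff.1 hx).lt_or_eq with hlt | heq
      · exact ⟨x, by simpa using hlt, rfl⟩
      · have : g t x = x := by simp [hg, hh, hfix x heq]
        rw [this, mem_ball_zero_iff] at hy1
        exact absurd heq hy1.ne
  let μ : Measure V := volume
  have hInt : ∀ t : ℝ, IntegrableOn (fun x => (1 + t • fderiv ℝ h x : V →L[ℝ] V).det)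
      (ball 0 1) μ := by
    intro t
    have : ContinuousOn (fun x => (1 + t • fderiv ℝ h x : V →L[ℝ] V).det) (closedBall 0 1) :=
      ContinuousLinearMap.continuous_det.comp_continuousOn
        (continuousOn_const.add ((hcf.mono hB).const_smul t))
    exact (this.integrableOn_compact hcompact).mono_set hball
  have hvol : ∀ t ∈ Ioo 0 ε, ∫ x in ball 0 1, (1 + t • fderiv ℝ h x : V →L[ℝ] V).det ∂μ =
      μ.real (ball 0 1) := by
    intro t ht
    have h1 := lintegral_abs_det_fderiv_eq_addHaar_image μ (measurableSet_ball (x := (0 : V)) (ε := 1))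
      (fun x hx => (hgd t x (hB (hball hx))).hasFDerivWithinAt) ((hinj t ht).mono hball)
    rw [himage t ht] at h1
    rw [integral_eq_lintegral_of_nonneg_ae, Measure.real, ← h1]
    · congr 1
      refine setLIntegral_congr_fun measurableSet_ball fun x hx => ?_
      rw [abs_of_pos (hdet t ht x (hball hx))]
    · refine (ae_restrict_iff' measurableSet_ball).2 (Eventually.of_forall fun x hx => ?_)
      exact (hdet t ht x (hball hx)).le
    · exact (hInt t).aestronglyMeasurable
  -- Differentiating |r|² = 1 makes the range of the derivative orthogonal to `r x`; if the
  -- derivative were invertible, `r x` itself would lie in that range.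
  have hdet0 : ∀ x ∈ ball (0 : V) 1, (1 + (1 : ℝ) • fderiv ℝ h x : V →L[ℝ] V).det = 0 := by
    intro x hx
    by_contra hd
    have hxO := hB (hball hx)
    have hrd : HasFDerivAt r (1 + (1 : ℝ) • fderiv ℝ h x : V →L[ℝ] V) x := by
      have := hgd 1 x hxO
      have e : g 1 = r := by ext y; simp [hg, hh]
      rwa [e] at this
    obtain ⟨v, hv⟩ := ((1 + (1 : ℝ) • fderiv ℝ h x :
      V →L[ℝ] V).toContinuousLinearEquivOfDetNeZero hd).surjective (r x)
    have hv' : (1 + (1 : ℝ) • fderiv ℝ h x : V →L[ℝ] V) v = r x := by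
      rw [← hv]; simp
    have h1 : HasFDerivAt (fun y => ‖r y‖ ^ 2) _ x := hrd.norm_sq
    have h2 : (fun y => ‖r y‖ ^ 2) =ᶠ[𝓝 x] fun _ => (1 : ℝ) := by
      filter_upwards [isOpen_ball.mem_nhds hx] with y hy
      rw [hr1 y (hball hy)]; norm_num
    have h3 := h1.unique ((hasFDerivAt_const (1 : ℝ) x).congr_of_eventuallyEq h2)
    have h4 := congrArg (fun L : V →L[ℝ] ℝ => L v) h3
    simp only [smul_apply, ContinuousLinearMap.comp_apply, hv',
      innerSL_apply_apply, real_inner_self_eq_norm_sq, hr1 x (hball hx)] at h4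
    norm_num at h4
  -- Dimension plus one small parameters determine the polynomial, hence its value at `t = 1`.
  obtain ⟨s, hsub, hcard⟩ := (Ioo_infinite hεpos).exists_subset_card_eq (Module.finrank ℝ V + 1)
  have key : ∫ x in ball 0 1, (1 + (1 : ℝ) • fderiv ℝ h x : V →L[ℝ] V).det ∂μ =
      ∑ u ∈ s, μ.real (ball 0 1) * (Lagrange.basis s id u).eval 1 := by
    have hfin : Module.finrank ℝ V < s.card := by omega
    simp_rw [fun x => det_one_add_smul_eq_sum s hfin (fderiv ℝ h x) (1 : ℝ)]
    rw [integral_finsetSum _ fun u _ => (hInt u).mul_const _]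
    refine Finset.sum_congr rfl fun u hu => ?_
    rw [integral_mul_const, hvol u (hsub hu)]
  rw [setIntegral_congr_fun measurableSet_ball hdet0, ← Finset.mul_sum,
    ← Polynomial.eval_finsetSum,
    Lagrange.sum_basis (Set.injOn_id _) (Finset.card_pos.1 (by omega))] at key
  have hpos : 0 < μ.real (ball (0 : V) 1) :=
    ENNReal.toReal_pos (measure_ball_pos _ _ one_pos).ne' measure_ball_lt_top.ne
  simp at key
  linarith

open scoped RealInnerProductSpace in
/-- Brouwer's fixed point theorem for `C¹` self-maps of the unit ball. -/
theorem exists_fixedPoint_of_contDiff {f : V → V} (hf : ContDiff ℝ 1 f)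
    (hm : MapsTo f (closedBall 0 1) (closedBall 0 1)) : ∃ x ∈ closedBall (0 : V) 1, f x = x := by
  borelize V
  by_contra! hne
  set u : V → V := fun x => x - f x with hu
  -- A quarter of the discriminant of |x + λ u|² = 1 in λ. The larger root is where the ray from `f
  -- x` through `x` leaves the ball, which gives the forbidden retraction.
  set D : V → ℝ := fun x => ⟪x, u x⟫ ^ 2 + ‖u x‖ ^ 2 * (1 - ‖x‖ ^ 2) with hD
  have hu1 : ContDiff ℝ 1 u := contDiff_id.sub hf
  have hin : ContDiff ℝ 1 fun x => ⟪x, u x⟫ := contDiff_id.inner ℝ hu1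
  have hD1 : ContDiff ℝ 1 D :=
    (hin.pow 2).add ((hu1.norm_sq ℝ).mul (contDiff_const.sub (contDiff_id.norm_sq ℝ)))
  have hune : ∀ x ∈ closedBall (0 : V) 1, u x ≠ 0 := fun x hx h =>
    hne x hx (sub_eq_zero.1 h).symm
  have hinpos : ∀ x, ‖x‖ = 1 → 0 < ⟪x, u x⟫ := by
    intro x hx
    have hxB : x ∈ closedBall (0 : V) 1 := by simp [hx]
    have h1 : 0 < ‖x - f x‖ := norm_pos_iff.2 (hune x hxB)
    have h2 : ‖f x‖ ≤ 1 := by simpa using hm hxB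
    have h3 := norm_sub_sq_real x (f x)
    have h4 : ⟪x, u x⟫ = ‖x‖ ^ 2 - ⟪x, f x⟫ := by
      simp only [hu, inner_sub_right, real_inner_self_eq_norm_sq]
    rw [h4, hx]
    rw [hx] at h3
    nlinarith [norm_nonneg (f x)]
  have hDpos : ∀ x ∈ closedBall (0 : V) 1, 0 < D x := by
    intro x hx
    have hun : 0 < ‖u x‖ := norm_pos_iff.2 (hune x hx)
    rcases (mem_closedBall_zero_iff.1 hx).lt_or_eq with h | h
    · have : 0 < 1 - ‖x‖ ^ 2 := by nlinarith [norm_nonneg x]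
      simp only [hD]; positivity
    · have := hinpos x h
      simp only [hD, h]; norm_num; positivity
  refine not_exists_retraction_sphere (O := {x | 0 < D x} ∩ {x | u x ≠ 0})
    (r := fun x => x + ((-⟪x, u x⟫ + √(D x)) / ‖u x‖ ^ 2) • u x) ?_ ?_ ?_ ?_ ?_
  · exact (isOpen_lt continuous_const hD1.continuous).inter
      (isOpen_ne_fun hu1.continuous continuous_const)
  · exact fun x hx => ⟨hDpos x hx, hune x hx⟩
  · intro x hx
    have h1 : ContDiffAt ℝ 1 (fun x => √(D x)) x := hD1.contDiffAt.sqrt hx.1.ne'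
    exact (contDiffAt_id.add (((hin.contDiffAt.neg.add h1).div (hu1.norm_sq ℝ).contDiffAt
      (pow_ne_zero 2 (norm_ne_zero_iff.2 hx.2))).smul hu1.contDiffAt)).contDiffWithinAt
  · intro x hx
    have hun : ‖u x‖ ≠ 0 := norm_ne_zero_iff.2 (hune x hx)
    have h1 := Real.sq_sqrt (hDpos x hx).le
    rw [← sq_eq_sq₀ (norm_nonneg _) zero_le_one, norm_add_sq_real, norm_smul, inner_smul_right,
      mul_pow, Real.norm_eq_abs, sq_abs]
    field_simp
    have h2 : D x = ⟪x, u x⟫ ^ 2 + ‖u x‖ ^ 2 * (1 - ‖x‖ ^ 2) := rfl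
    linear_combination h1 + h2
  · intro x hx
    have h1 := hinpos x hx
    have h2 : D x = ⟪x, u x⟫ ^ 2 := by simp [hD, hx]
    simp only [h2, Real.sqrt_sq h1.le]
    simp

/-- **Brouwer's fixed point theorem** for the closed unit ball. -/
theorem exists_fixedPoint_of_continuousOn {f : V → V} (hf : ContinuousOn f (closedBall 0 1))
    (hm : MapsTo f (closedBall 0 1) (closedBall 0 1)) : ∃ x ∈ closedBall (0 : V) 1, f x = x := by
  by_contra! hne
  have hcompact : IsCompact (closedBall (0 : V) 1) := isCompact_closedBall _ _
  obtain ⟨x₀, hx₀, hmin⟩ := hcompact.exists_isMinOn ⟨0, by simp⟩ (continuousOn_id.sub hf).norm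
  set μ := ‖x₀ - f x₀‖ with hμ
  have hμpos : 0 < μ := norm_pos_iff.2 (sub_ne_zero.2 (hne x₀ hx₀).symm)
  have : TietzeExtension V := .of_tvs ℝ
  obtain ⟨F, hF⟩ := ContinuousMap.exists_restrict_eq isClosed_closedBall
    (⟨(closedBall (0 : V) 1).domRestrict f, hf.domRestrict⟩ : C(closedBall (0 : V) 1, V))
  have hFe : ∀ x ∈ closedBall (0 : V) 1, F x = f x := fun x hx =>
    congrArg (fun G : C(closedBall (0 : V) 1, V) => G ⟨x, hx⟩) hF
  obtain ⟨g, hg, hgF, -⟩ := F.continuous.exists_contDiff_approx 1 (ε := fun _ => μ / 4)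
    continuous_const fun _ => by positivity
  have hgn : ∀ x ∈ closedBall (0 : V) 1, ‖g x‖ ≤ 1 + μ / 4 := by
    intro x hx
    have h1 := hgF x
    rw [hFe x hx, dist_eq_norm] at h1
    have h2 : ‖f x‖ ≤ 1 := by simpa using hm hx
    have h3 := norm_sub_norm_le (g x) (f x)
    linarith
  -- Rescaling by 1 + μ/4 brings the smooth approximation back into the ball. Its fixed point is
  -- moved by `f` less than μ/4 + μ/4, below the minimal displacement μ.
  obtain ⟨x, hx, hfix⟩ := exists_fixedPoint_of_contDiff (f := fun x => (1 + μ / 4)⁻¹ • g x)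
    (hg.const_smul _) (by
      intro x hx
      rw [mem_closedBall_zero_iff, norm_smul, Real.norm_of_nonneg (by positivity),
        inv_mul_le_iff₀ (by positivity), mul_one]
      exact hgn x hx)
  have h1 : μ ≤ ‖x - f x‖ := hmin hx
  have h2 : g x = (1 + μ / 4) • x := by
    rw [← inv_smul_eq_iff₀ (by positivity), hfix]
  have h3 := hgF x
  rw [hFe x hx, dist_eq_norm, h2] at h3
  have h4 : x - f x = ((1 + μ / 4) • x - f x) - (μ / 4) • x := by module
  have h5 : ‖(μ / 4) • x‖ ≤ μ / 4 := by
    rw [norm_smul, Real.norm_of_nonneg (by positivity)]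
    have : ‖x‖ ≤ 1 := by simpa using hx
    nlinarith
  have h6 := norm_sub_le ((1 + μ / 4) • x - f x) ((μ / 4) • x)
  rw [← h4] at h6
  linarith

/-- A continuous injective image of the unit ball contains a neighbourhood of the image of the
centre. -/
theorem image_closedBall_mem_nhds {f : V → V} (hf : ContinuousOn f (closedBall 0 1))
    (hinj : InjOn f (closedBall 0 1)) : f '' closedBall 0 1 ∈ 𝓝 (f 0) := by
  borelize V
  have hcompact : IsCompact (closedBall (0 : V) 1) := isCompact_closedBall _ _
  have hQ : IsCompact (f '' closedBall 0 1) := hcompact.image_of_continuousOn hf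
  set Q := f '' closedBall 0 1 with hQdef
  have : TietzeExtension V := .of_tvs ℝ
  have : CompactSpace (closedBall (0 : V) 1) := isCompact_iff_compactSpace.1 hcompact
  -- a continuous extension `G` of the inverse of `f`
  have hemb : IsClosedEmbedding ((closedBall (0 : V) 1).domRestrict f) :=
    hf.domRestrict.isClosedEmbedding (injOn_iff_injective.1 hinj)
  obtain ⟨G, hG⟩ := ContinuousMap.exists_extension hemb
    (⟨Subtype.val, continuous_subtype_val⟩ : C(closedBall (0 : V) 1, V))
  have hGf : ∀ x ∈ closedBall (0 : V) 1, G (f x) = x := fun x hx =>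
    congrArg (fun H : C(closedBall (0 : V) 1, V) => H ⟨x, hx⟩) hG
  have h0 : (0 : V) ∈ closedBall (0 : V) 1 := by simp
  -- The zero of `G` is stable: `x - H (f x)` equals `G (f x) - H (f x)`, so it maps the ball to
  -- itself and Brouwer applies. The rest of the proof builds a nearby `H` without zeros, under the
  -- assumption that `f 0` is not interior to `Q`.
  have hstable : ∀ H : V → V, ContinuousOn H Q → (∀ y ∈ Q, ‖G y - H y‖ ≤ 1) → ∃ y ∈ Q, H y = 0 := by
    intro H hH hGH
    obtain ⟨x, hx, hfix⟩ := exists_fixedPoint_of_continuousOn (f := fun x => x - H (f x))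
      (continuousOn_id.sub (hH.comp hf (mapsTo_image _ _))) (by
        intro x hx
        have := hGH (f x) (mem_image_of_mem _ hx)
        rw [hGf x hx] at this
        simpa using this)
    exact ⟨f x, mem_image_of_mem _ hx, by simpa using hfix⟩
  by_contra hnot
  obtain ⟨ε₀, hε₀, hGε⟩ := Metric.continuousAt_iff.1 (G.continuous.continuousAt (x := f 0)) (1 / 10)
    (by norm_num)
  rw [hGf 0 h0] at hGε
  set ε := ε₀ / 3 with hε
  have hεpos : 0 < ε := by positivity
  obtain ⟨c, hcε, hcQ⟩ : ∃ c, dist c (f 0) < ε ∧ c ∉ Q := by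
    by_contra! hall
    exact hnot (Metric.mem_nhds_iff.2 ⟨ε, hεpos, fun c hc => hall c hc⟩)
  set S₁ : Set V := Q ∩ {y | ε ≤ dist y c} with hS₁
  have hS₁c : IsCompact S₁ := hQ.inter_right (isClosed_le continuous_const (by fun_prop))
  have hGne : ∀ y ∈ S₁, G y ≠ 0 := by
    rintro _ ⟨⟨x, hx, rfl⟩, hy⟩ h
    rw [hGf x hx] at h
    subst h
    rw [mem_ofPred_eq, dist_comm] at hy
    exact absurd hcε (not_lt.2 hy)
  obtain ⟨δ, hδ, hδ1, hδG⟩ : ∃ δ : ℝ, 0 < δ ∧ δ ≤ 1 / 10 ∧ ∀ y ∈ S₁, δ ≤ ‖G y‖ := by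
    rcases S₁.eq_empty_or_nonempty with he | hne
    · exact ⟨1 / 10, by norm_num, le_rfl, by simp [he]⟩
    · obtain ⟨y₀, hy₀, hmin⟩ := hS₁c.exists_isMinOn hne G.continuous.norm.continuousOn
      exact ⟨min ‖G y₀‖ (1 / 10), lt_min (norm_pos_iff.2 (hGne y₀ hy₀)) (by norm_num),
        min_le_right _ _, fun y hy => (min_le_left _ _).trans (hmin hy)⟩
  obtain ⟨P, hP, hPG, -⟩ := G.continuous.exists_contDiff_approx 1 (ε := fun _ => δ / 2)
    continuous_const fun _ => by positivity
  -- a generic small translation of `P` does not vanish on the sphere around `c`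
  have hnull : volume (P '' sphere c ε) = 0 :=
    addHaar_image_eq_zero_of_differentiableOn_of_addHaar_eq_zero _
      (hP.differentiable one_ne_zero).differentiableOn
      (Measure.addHaar_sphere_of_ne_zero _ _ hεpos.ne')
  obtain ⟨w, hw, hwP⟩ : ∃ w ∈ ball (0 : V) (δ / 2), w ∉ P '' sphere c ε := by
    by_contra! hall
    have := measure_mono_null hall hnull
    exact (measure_ball_pos volume (0 : V) (half_pos hδ)).ne' this
  rw [mem_ball_zero_iff] at hw
  -- Radial projection away from the missing point `c`: it pushes `Q` out of the ball of radius ε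
  -- about `c`, onto `S₁` and the sphere. On `S₁` a close approximation of `G` has no zero, and on
  -- the null image of the sphere zeros are avoided by the translation `w`.
  set Φ : V → V := fun y => c + max (ε / dist y c) 1 • (y - c) with hΦ
  have hΦ1 : ∀ y, ε ≤ dist y c → Φ y = y := by
    intro y hy
    have : 0 < dist y c := hεpos.trans_le hy
    simp only [hΦ]
    rw [max_eq_right ((div_le_one this).2 hy), one_smul]; abel
  have hΦ2 : ∀ y ∈ Q, dist y c ≤ ε → dist (Φ y) c = ε := by
    intro y hyQ hy
    have : 0 < dist y c := dist_pos.2 fun h => hcQ (h ▸ hyQ)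
    simp only [hΦ]
    rw [max_eq_left ((one_le_div this).2 hy), dist_eq_norm, add_sub_cancel_left, norm_smul,
      Real.norm_of_nonneg (by positivity), ← dist_eq_norm, div_mul_cancel₀ _ this.ne']
  have hΦc : ContinuousOn Φ Q := by
    refine continuousOn_const.add (ContinuousOn.smul ?_ (by fun_prop))
    refine ContinuousOn.sup (continuousOn_const.div (by fun_prop) fun y hy => ?_) continuousOn_const
    exact (dist_pos.2 fun h : y = c => hcQ (h ▸ hy)).ne'
  have hPw : ∀ y, ‖G y - (P y - w)‖ < δ := by
    intro y
    have h1 := hPG y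
    rw [dist_comm, dist_eq_norm] at h1
    calc ‖G y - (P y - w)‖ = ‖(G y - P y) + w‖ := by congr 1; abel
      _ ≤ ‖G y - P y‖ + ‖w‖ := norm_add_le _ _
      _ < δ := by linarith
  have hsmall : ∀ y, dist y c ≤ ε → ‖G y‖ ≤ 1 / 10 := by
    intro y hy
    have : dist y (f 0) < ε₀ := by
      have := dist_triangle y c (f 0)
      linarith
    simpa using (hGε this).le
  -- Inside the ball about `c` both `G y` and `G (Φ y)` have norm at most 1/10, so the deviation is
  -- at most 1/10 + 1/10 + δ ≤ 3/10; outside it is less than δ.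
  obtain ⟨y, hyQ, hy0⟩ := hstable (fun y => P (Φ y) - w)
    ((hP.continuous.comp_continuousOn hΦc).sub continuousOn_const) (by
      intro y hy
      rcases le_total ε (dist y c) with h | h
      · simp only [hΦ1 y h]
        exact (hPw y).le.trans (by linarith)
      · have h1 := hsmall y h
        have h2 := hsmall (Φ y) (hΦ2 y hy h).le
        have h3 := (hPw (Φ y)).le
        have h4 : G y - (P (Φ y) - w) = G y - G (Φ y) + (G (Φ y) - (P (Φ y) - w)) := by abel
        rw [h4]
        have h5 := norm_add_le (G y - G (Φ y)) (G (Φ y) - (P (Φ y) - w))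
        have h6 := norm_sub_le (G y) (G (Φ y))
        linarith)
  rcases le_or_gt ε (dist y c) with h | h
  · have h1 := hPw y
    simp only [hΦ1 y h] at hy0
    rw [hy0, sub_zero] at h1
    exact absurd (hδG y ⟨hyQ, h⟩) (not_le.2 h1)
  · exact hwP ⟨Φ y, hΦ2 y hyQ h.le, sub_eq_zero.1 hy0⟩

/-- **Invariance of domain**. -/
theorem isOpen_image_of_continuousOn_injOn {U : Set V} (hU : IsOpen U) {f : V → V}
    (hf : ContinuousOn f U) (hinj : InjOn f U) : IsOpen (f '' U) := by
  rw [isOpen_iff_mem_nhds]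
  rintro _ ⟨x, hx, rfl⟩
  obtain ⟨ε, hε, hεU⟩ := nhds_basis_closedBall.mem_iff.1 (hU.mem_nhds hx)
  have hmaps : ∀ z ∈ closedBall (0 : V) 1, x + ε • z ∈ U := by
    intro z hz
    refine hεU ?_
    rw [mem_closedBall, dist_eq_norm, add_sub_cancel_left, norm_smul, Real.norm_of_nonneg hε.le]
    have : ‖z‖ ≤ 1 := by simpa using hz
    nlinarith
  have h := image_closedBall_mem_nhds (f := fun z => f (x + ε • z))
    (hf.comp (by fun_prop) hmaps) (by
      intro a ha b hb hab
      have := hinj (hmaps a ha) (hmaps b hb) hab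
      exact smul_right_injective V hε.ne' (add_left_cancel this))
  simp only [smul_zero, add_zero] at h
  refine Filter.mem_of_superset h ?_
  rintro _ ⟨z, hz, rfl⟩
  exact ⟨_, hmaps z hz, rfl⟩

end InvarianceOfDomain

/-! ### Elementary properties and bounds of the Kobayashi metric and distance. -/

section KobayashiBasics

open Set Metric MeasureTheory Filter Topology

variable {n : ℕ} {Ω : Set (Cn n)}

theorem kobayashiMetric_le {x v : Cn n} {φ : ℂ → Cn n} {ξ : ℂ}
    (hφ : DifferentiableOn ℂ φ (ball 0 1)) (hm : MapsTo φ (ball 0 1) Ω) (h0 : φ 0 = x)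
    (hv : ξ • deriv φ 0 = v) : kobayashiMetric Ω x v ≤ ‖ξ‖ₑ :=
  iInf_le_of_le φ <| iInf_le_of_le ξ <| iInf_le_of_le hφ <| iInf_le_of_le hm <|
    iInf_le_of_le h0 <| iInf_le_of_le hv le_rfl

/-- Reversal and reparametrisation of curves multiply velocities by -1 and 2, and for them this
inequality is enough. A nonzero factor passes through the infimum in `ℝ≥0∞`. -/
theorem kobayashiMetric_smul_le {x v : Cn n} {a : ℂ} (ha : a ≠ 0) :
    kobayashiMetric Ω x (a • v) ≤ ‖a‖ₑ * kobayashiMetric Ω x v := by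
  have h1 : ‖a‖ₑ ≠ 0 := enorm_ne_zero.2 ha
  simp only [kobayashiMetric, ENNReal.mul_iInf_of_ne h1 enorm_ne_top]
  refine le_iInf fun φ => le_iInf fun ξ => le_iInf fun hφ => le_iInf fun hm => le_iInf fun h0 =>
    le_iInf fun hv => ?_
  rw [← enorm_mul]
  exact kobayashiMetric_le hφ hm h0 (by rw [mul_smul, hv])

/-- Upper bound for the Kobayashi metric by a round disc in a complex line. -/
theorem kobayashiMetric_le_of_disc {p w : Cn n} {c R t : ℝ} (ht : |t - c| < R)
    (hΩ : ∀ z : ℂ, ‖z - c‖ < R → p + z • w ∈ Ω) (a : ℝ) :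
    kobayashiMetric Ω (p + (t : ℂ) • w) (a • w) ≤
      ENNReal.ofReal (|a| * (R / (R ^ 2 - (t - c) ^ 2))) := by
  have hR : 0 < R := (abs_nonneg _).trans_lt ht
  -- The affine disc is precomposed with the Möbius map ζ ↦ (ζ + b) / (1 + bζ), which sends 0 to the
  -- relative position of `t`. Its derivative 1 - b² at 0 produces the Poincaré density R / (R² - (t
  -- - c)²).
  set b : ℝ := (t - c) / R with hb
  have hb1 : |b| < 1 := by rw [hb, abs_div, abs_of_pos hR, div_lt_one hR]; exact ht
  have hb2 : 0 < 1 - b ^ 2 := by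
    have := (sq_lt_one_iff_abs_lt_one b).2 hb1
    linarith
  have hden : ∀ ζ : ℂ, ‖ζ‖ < 1 → (1 + (b : ℂ) * ζ) ≠ 0 := by
    intro ζ hζ h0
    have h1 : (b : ℂ) * ζ = -1 := by linear_combination h0
    have h2 : |b| * ‖ζ‖ = 1 := by
      have := congrArg norm h1
      simpa using this
    nlinarith [abs_nonneg b, norm_nonneg ζ]
  have hmob : ∀ ζ : ℂ, ‖ζ‖ < 1 → ‖(ζ + b) / (1 + b * ζ)‖ < 1 := by
    intro ζ hζ
    rw [norm_div, div_lt_one (norm_pos_iff.2 (hden ζ hζ)), ← sq_lt_sq₀ (norm_nonneg _) (norm_nonneg _),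
      ← Complex.normSq_eq_norm_sq, ← Complex.normSq_eq_norm_sq]
    have h1 : ‖ζ‖ ^ 2 < 1 := by nlinarith [norm_nonneg ζ]
    rw [← Complex.normSq_eq_norm_sq, Complex.normSq_apply] at h1
    simp only [Complex.normSq_apply, Complex.add_re, Complex.add_im, Complex.mul_re, Complex.mul_im,
      Complex.ofReal_re, Complex.ofReal_im, Complex.one_re, Complex.one_im]
    nlinarith
  have hd : ∀ ζ : ℂ, ‖ζ‖ < 1 → HasDerivAt (fun ζ : ℂ => p + ((c : ℂ) + R * ((ζ + b) / (1 + b * ζ))) • w)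
      (((R : ℂ) * ((1 * (1 + b * ζ) - (ζ + b) * (b * 1)) / (1 + b * ζ) ^ 2)) • w) ζ := by
    intro ζ hζ
    have h1 : HasDerivAt (fun ζ : ℂ => (ζ + b) / (1 + b * ζ))
        ((1 * (1 + b * ζ) - (ζ + b) * (b * 1)) / (1 + b * ζ) ^ 2) ζ :=
      ((hasDerivAt_id ζ).add_const _).div (((hasDerivAt_id ζ).const_mul (b : ℂ)).const_add 1)
        (hden ζ hζ)
    exact (((h1.const_mul (R : ℂ)).const_add (c : ℂ)).smul_const w).const_add p
  have hRb : R * (1 - b ^ 2) ≠ 0 := by positivity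
  refine (kobayashiMetric_le (φ := fun ζ : ℂ => p + ((c : ℂ) + R * ((ζ + b) / (1 + b * ζ))) • w)
    (ξ := ((a / (R * (1 - b ^ 2)) : ℝ) : ℂ)) ?_ ?_ ?_ ?_).trans ?_
  · intro ζ hζ
    exact (hd ζ (by simpa using hζ)).differentiableAt.differentiableWithinAt
  · intro ζ hζ
    refine hΩ _ ?_
    rw [add_sub_cancel_left, norm_mul, Complex.norm_real, Real.norm_of_nonneg hR.le]
    have := hmob ζ (by simpa using hζ)
    nlinarith
  · have : (R : ℂ) * ((0 + b) / (1 + b * 0)) = t - c := by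
      rw [hb]; push_cast
      have : (R : ℂ) ≠ 0 := by exact_mod_cast hR.ne'
      simp only [mul_zero, add_zero, div_one, zero_add]
      field_simp
    simp only [this]
    simp
  · rw [(hd 0 (by simp)).deriv, smul_smul, ← Complex.coe_smul]
    congr 1
    have h2 : (R : ℂ) * (1 - (b : ℂ) ^ 2) ≠ 0 := by exact_mod_cast hRb
    have h3 : (R : ℂ) * ((1 * (1 + (b : ℂ) * 0) - (0 + b) * (b * 1)) / (1 + b * 0) ^ 2) =
        R * (1 - (b : ℂ) ^ 2) := by
      simp only [mul_zero, add_zero, one_pow, div_one, zero_add]; ring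
    rw [h3]
    push_cast
    exact div_mul_cancel₀ _ h2
  · rw [← ofReal_norm, Complex.norm_real]
    refine ENNReal.ofReal_le_ofReal (le_of_eq ?_)
    rw [Real.norm_eq_abs, abs_div, abs_of_pos (by positivity : 0 < R * (1 - b ^ 2)), hb]
    have : R ^ 2 - (t - c) ^ 2 ≠ 0 := by
      have := sq_lt_sq' (by linarith [(abs_lt.1 ht).1]) (abs_lt.1 ht).2
      linarith
    field_simp

theorem kobayashiMetric_le_of_ball {z v : Cn n} {r : ℝ} (hr : 0 < r) (hΩ : ball z r ⊆ Ω) :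
    kobayashiMetric Ω z v ≤ ENNReal.ofReal (‖v‖ / r) := by
  by_cases hv : v = 0
  · subst hv
    refine (kobayashiMetric_le (φ := fun _ => z) (ξ := 0) (differentiableOn_const _) ?_ rfl ?_).trans ?_
    · intro _ _; exact hΩ (mem_ball_self hr)
    · simp
    · simp
  · have hv' : 0 < ‖v‖ := norm_pos_iff.2 hv
    have h := kobayashiMetric_le_of_disc (Ω := Ω) (p := z) (w := v) (c := 0) (R := r / ‖v‖) (t := 0)
      (by simpa using div_pos hr hv') (by
        intro ζ hζ
        refine hΩ ?_
        rw [mem_ball, dist_eq_norm, add_sub_cancel_left, norm_smul]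
        rw [Complex.ofReal_zero, sub_zero, lt_div_iff₀ hv'] at hζ
        exact hζ) 1
    simp only [Complex.ofReal_zero, zero_smul, add_zero, one_smul, abs_one, one_mul, sub_zero] at h
    refine h.trans (ENNReal.ofReal_le_ofReal (le_of_eq ?_))
    field_simp
    simp

/-- Lower bound for the Kobayashi metric of a domain contained in a half space. -/
theorem le_kobayashiMetric_of_halfSpace {L : Cn n →L[ℂ] ℂ} {a : ℂ} (hL : ∀ y ∈ Ω, 0 < (L y - a).re)
    (z v : Cn n) : ENNReal.ofReal (‖L v‖ / (2 * (L z - a).re)) ≤ kobayashiMetric Ω z v := by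
  refine le_iInf fun φ => le_iInf fun ξ => le_iInf fun hφ => le_iInf fun hm => le_iInf fun h0 =>
    le_iInf fun hv => ?_
  subst h0 hv
  have hB : (0 : ℂ) ∈ ball (0 : ℂ) 1 := by simp
  set h : ℂ → ℂ := fun ζ => L (φ ζ) - a with hh
  have hpos : ∀ ζ ∈ ball (0 : ℂ) 1, 0 < (h ζ).re := fun ζ hζ => hL _ (hm hζ)
  have hd : ∀ ζ ∈ ball (0 : ℂ) 1, HasDerivAt h (L (deriv φ ζ)) ζ := by
    intro ζ hζ
    have h1 := (hφ.differentiableAt (isOpen_ball.mem_nhds hζ)).hasDerivAt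
    exact (L.hasFDerivAt.comp_hasDerivAt ζ h1).sub_const a
  -- The Cayley transform takes the right half plane to the disc and `h 0` to 0, so that the Schwarz
  -- lemma bounds |L φ'(0)| by 2 Re h(0).
  set q : ℂ → ℂ := fun ζ => (h ζ - h 0) / (h ζ + (starRingEnd ℂ) (h 0)) with hq
  have hne : ∀ ζ ∈ ball (0 : ℂ) 1, h ζ + (starRingEnd ℂ) (h 0) ≠ 0 := by
    intro ζ hζ h1
    have h2 := congrArg Complex.re h1
    simp only [Complex.add_re, Complex.conj_re, Complex.zero_re] at h2
    linarith [hpos ζ hζ, hpos 0 hB]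
  have hqd : ∀ ζ ∈ ball (0 : ℂ) 1, HasDerivAt q
      ((L (deriv φ ζ) * (h ζ + (starRingEnd ℂ) (h 0)) - (h ζ - h 0) * L (deriv φ ζ)) /
        (h ζ + (starRingEnd ℂ) (h 0)) ^ 2) ζ := fun ζ hζ =>
    ((hd ζ hζ).sub_const _).div ((hd ζ hζ).add_const _) (hne ζ hζ)
  have hq0 : q 0 = 0 := by simp [hq]
  have hmaps : MapsTo q (ball 0 1) (closedBall (q 0) 1) := by
    intro ζ hζ
    rw [hq0, mem_closedBall_zero_iff, norm_div, div_le_one (norm_pos_iff.2 (hne ζ hζ)),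
      ← sq_le_sq₀ (norm_nonneg _) (norm_nonneg _), ← Complex.normSq_eq_norm_sq,
      ← Complex.normSq_eq_norm_sq]
    have h1 := hpos ζ hζ
    have h2 := hpos 0 hB
    simp only [Complex.normSq_apply, Complex.add_re, Complex.add_im, Complex.sub_re, Complex.sub_im,
      Complex.conj_re, Complex.conj_im]
    nlinarith
  have hS := Complex.norm_deriv_le_one_of_mapsTo_ball
    (fun ζ hζ => (hqd ζ hζ).differentiableAt.differentiableWithinAt) hmaps one_pos
  have hre : h 0 + (starRingEnd ℂ) (h 0) = ((2 * (h 0).re : ℝ) : ℂ) := by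
    rw [Complex.add_conj]
  have h0pos : 0 < 2 * (h 0).re := by linarith [hpos 0 hB]
  rw [(hqd 0 hB).deriv, sub_self, zero_mul, sub_zero, hre, norm_div, norm_mul, norm_pow,
    Complex.norm_real, Real.norm_of_nonneg h0pos.le, div_le_one (by positivity), sq] at hS
  have hS' : ‖L (deriv φ 0)‖ ≤ 2 * (h 0).re := le_of_mul_le_mul_right hS h0pos
  rw [← ofReal_norm]
  refine ENNReal.ofReal_le_ofReal ?_
  rw [map_smul, smul_eq_mul, norm_mul, div_le_iff₀ h0pos]
  exact mul_le_mul_of_nonneg_left hS' (norm_nonneg _)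

theorem setLIntegral_Icc_add_Icc {a b c : ℝ} (hab : a ≤ b) (hbc : b ≤ c) (k : ℝ → ℝ≥0∞) :
    ∫⁻ t in Icc a c, k t = (∫⁻ t in Icc a b, k t) + ∫⁻ t in Icc b c, k t := by
  rw [setLIntegral_congr (Ioc_ae_eq_Icc (a := b) (b := c)).symm, ← Icc_union_Ioc_eq_Icc hab hbc,
    lintegral_union measurableSet_Ioc]
  exact disjoint_left.2 fun t h1 h2 => absurd h1.2 (not_le.2 h2.1)

/-- A function whose differential is dominated by the Kobayashi metric along a curve varies by at
most the Kobayashi length of the curve. -/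
theorem enorm_sub_le_lintegral_kobayashiMetric {γ : ℝ → Cn n} (hγ : IsPiecewiseC1 γ)
    {h : Cn n → ℝ} {a b : ℝ} (ha : 0 ≤ a) (hab : a ≤ b) (hb : b ≤ 1)
    (hh : ∀ t ∈ Icc a b, ContDiffAt ℝ 1 h (γ t))
    (hle : ∀ t ∈ Icc a b, ∀ v, ‖fderiv ℝ h (γ t) v‖ₑ ≤ kobayashiMetric Ω (γ t) v) :
    ‖h (γ b) - h (γ a)‖ₑ ≤ ∫⁻ t in Icc a b, kobayashiMetric Ω (γ t) (deriv γ t) := by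
  obtain ⟨N, t, hmono, h0, h1, hC⟩ := hγ
  -- the estimate on a single smooth piece
  have piece : ∀ i < N, ∀ a' b', a ≤ a' → a' ≤ b' → b' ≤ b → t i ≤ a' → b' ≤ t (i + 1) →
      ‖h (γ b') - h (γ a')‖ₑ ≤ ∫⁻ s in Icc a' b', kobayashiMetric Ω (γ s) (deriv γ s) := by
    intro i hi a' b' haa hab' hbb hta htb
    have hsub : Icc a' b' ⊆ Icc a b := Icc_subset_Icc haa hbb
    have hcd : ContDiffOn ℝ 1 γ (Icc a' b') := (hC i hi).mono (Icc_subset_Icc hta htb)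
    have hcomp : ContDiffOn ℝ 1 (h ∘ γ) (Icc a' b') := fun s hs =>
      (hh s (hsub hs)).comp_contDiffWithinAt s (hcd s hs)
    refine (enorm_sub_le_lintegral_deriv_of_contDiffOn_Icc hcomp hab').trans ?_
    rw [← restrict_Ioo_eq_restrict_Icc]
    refine setLIntegral_mono' measurableSet_Ioo fun s hs => ?_
    have hs' : s ∈ Icc a' b' := Ioo_subset_Icc_self hs
    have hγd : DifferentiableAt ℝ γ s :=
      ((hcd s hs').contDiffAt (Icc_mem_nhds hs.1 hs.2)).differentiableAt one_ne_zero
    have hhd := (hh s (hsub hs')).differentiableAt one_ne_zero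
    rw [show deriv (h ∘ γ) s = fderiv ℝ h (γ s) (deriv γ s) from
      (hhd.hasFDerivAt.comp_hasDerivAt s hγd.hasDerivAt).deriv]
    exact hle s (hsub hs') _
  have main : ∀ i ≤ N, ∀ a' b', a ≤ a' → a' ≤ b' → b' ≤ b → b' ≤ t i →
      ‖h (γ b') - h (γ a')‖ₑ ≤ ∫⁻ s in Icc a' b', kobayashiMetric Ω (γ s) (deriv γ s) := by
    intro i
    induction i with
    | zero =>
      intro _ a' b' haa hab' _ hbt
      have : a' = b' := by rw [h0] at hbt; linarith
      subst this; simp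
    | succ i ih =>
      intro hi a' b' haa hab' hbb hbt
      rcases le_total b' (t i) with h2 | h2
      · exact ih (by omega) a' b' haa hab' hbb h2
      rcases le_total (t i) a' with h3 | h3
      · exact piece i (by omega) a' b' haa hab' hbb h3 hbt
      rw [setLIntegral_Icc_add_Icc h3 h2]
      calc ‖h (γ b') - h (γ a')‖ₑ = ‖(h (γ (t i)) - h (γ a')) + (h (γ b') - h (γ (t i)))‖ₑ := by
            congr 1; ring
        _ ≤ _ := enorm_add_le _ _
        _ ≤ _ := add_le_add (ih (by omega) a' (t i) haa h3 (h2.trans hbb) le_rfl)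
            (piece i (by omega) (t i) b' (haa.trans h3) h2 hbb le_rfl hbt)
  exact main N le_rfl a b le_rfl hab le_rfl (by rwa [h1])

theorem IsPiecewiseC1.continuousOn {γ : ℝ → Cn n} (hγ : IsPiecewiseC1 γ) :
    ContinuousOn γ (Icc 0 1) := by
  obtain ⟨N, t, hmono, h0, h1, hC⟩ := hγ
  have : ∀ i ≤ N, ContinuousOn γ (Icc (t 0) (t i)) := by
    intro i
    induction i with
    | zero => intro _; simp
    | succ i ih =>
      intro hi
      rw [← Icc_union_Icc_eq_Icc (hmono (Nat.zero_le i)) (hmono (Nat.le_succ i))]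
      exact (ih (by omega)).union_of_isClosed (hC i (by omega)).continuousOn isClosed_Icc isClosed_Icc
  simpa [h0, h1] using this N le_rfl

theorem kobayashiDist_le {x y : Cn n} {γ : ℝ → Cn n} (hγ : IsPiecewiseC1 γ)
    (hm : MapsTo γ (Icc 0 1) Ω) (h0 : γ 0 = x) (h1 : γ 1 = y) :
    kobayashiDist Ω x y ≤ kobayashiLength Ω γ :=
  iInf_le_of_le γ <| iInf_le_of_le hγ <| iInf_le_of_le hm <| iInf_le_of_le h0 <|
    iInf_le_of_le h1 le_rfl

theorem le_kobayashiDist {x y : Cn n} {c : ℝ≥0∞} (h : ∀ γ : ℝ → Cn n, IsPiecewiseC1 γ →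
    MapsTo γ (Icc 0 1) Ω → γ 0 = x → γ 1 = y → c ≤ kobayashiLength Ω γ) :
    c ≤ kobayashiDist Ω x y :=
  le_iInf fun γ => le_iInf fun hγ => le_iInf fun hm => le_iInf fun h0 => le_iInf fun h1 =>
    h γ hγ hm h0 h1

theorem kobayashiDist_le_segment {x y : Cn n} (hm : ∀ t ∈ Icc (0 : ℝ) 1, x + t • (y - x) ∈ Ω) :
    kobayashiDist Ω x y ≤ ∫⁻ t in Icc (0 : ℝ) 1, kobayashiMetric Ω (x + t • (y - x)) (y - x) := by
  refine (kobayashiDist_le (γ := fun t : ℝ => x + t • (y - x)) ?_ hm (by simp) (by simp)).trans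
    (le_of_eq ?_)
  · refine ⟨1, fun i => i, Nat.mono_cast, by simp, by simp, fun i _ => ?_⟩
    exact (contDiff_const.add (contDiff_id.smul contDiff_const)).contDiffOn
  · unfold kobayashiLength
    congr 1
    ext t
    have : HasDerivAt (fun t : ℝ => x + t • (y - x)) (y - x) t := by
      simpa using ((hasDerivAt_id t).smul_const (y - x)).const_add x
    rw [this.deriv]

theorem IsPiecewiseC1.reverse {γ : ℝ → Cn n} (hγ : IsPiecewiseC1 γ) :
    IsPiecewiseC1 fun t => γ (1 - t) := by
  obtain ⟨N, t, hmono, ht0, ht1, hC⟩ := hγ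
  refine ⟨N, fun i => 1 - t (N - i), ?_, by simp [ht1], by simp [ht0], fun i hi => ?_⟩
  · intro i j hij
    have := hmono (show N - j ≤ N - i by omega)
    simp only; linarith
  · have hC' := hC (N - (i + 1)) (by omega)
    rw [show N - (i + 1) + 1 = N - i by omega] at hC'
    refine hC'.comp (contDiff_const.sub contDiff_id).contDiffOn fun s hs => ?_
    have h2 := hs.1
    have h3 := hs.2
    simp only at *
    constructor <;> linarith

theorem lintegral_kobayashiMetric_reverse_le (γ : ℝ → Cn n) (a b : ℝ) :
    ∫⁻ t in Icc (1 - b) (1 - a), kobayashiMetric Ω (γ (1 - t)) (deriv (fun t => γ (1 - t)) t) ≤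
      ∫⁻ t in Icc a b, kobayashiMetric Ω (γ t) (deriv γ t) := by
  have hA : ∀ s : ℝ, HasDerivAt (fun t : ℝ => 1 - t) (-1) s := fun s => by
    simpa using (hasDerivAt_id s).const_sub 1
  have himg : (fun t : ℝ => 1 - t) '' Icc (1 - b) (1 - a) = Icc a b := by simp
  conv_rhs => rw [← himg, lintegral_image_eq_lintegral_abs_deriv_mul measurableSet_Icc
    (fun s _ => (hA s).hasDerivWithinAt) (fun a _ b _ hab => by simpa using hab)]
  refine lintegral_mono fun s => ?_
  have hd : deriv (fun t => γ (1 - t)) s = (-1 : ℂ) • deriv γ (1 - s) := by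
    rw [deriv_comp_const_sub]; simp
  rw [hd]
  refine (kobayashiMetric_smul_le (by simp)).trans ?_
  simp

theorem kobayashiDist_symm_le (x y : Cn n) : kobayashiDist Ω x y ≤ kobayashiDist Ω y x := by
  refine le_kobayashiDist fun γ hγ hm h0 h1 => ?_
  refine (kobayashiDist_le hγ.reverse ?_ (by simpa using h1) (by simpa using h0)).trans ?_
  · intro t ht
    exact hm ⟨by linarith [ht.2], by linarith [ht.1]⟩
  · simpa using! lintegral_kobayashiMetric_reverse_le (Ω := Ω) γ 0 1

theorem kobayashiDist_comm (x y : Cn n) : kobayashiDist Ω x y = kobayashiDist Ω y x :=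
  (kobayashiDist_symm_le x y).antisymm (kobayashiDist_symm_le y x)

theorem kobayashiDist_triangle (x y z : Cn n) :
    kobayashiDist Ω x z ≤ kobayashiDist Ω x y + kobayashiDist Ω y z := by
  have key : ∀ γ₁ : ℝ → Cn n, IsPiecewiseC1 γ₁ → MapsTo γ₁ (Icc 0 1) Ω → γ₁ 0 = x → γ₁ 1 = y →
      ∀ γ₂ : ℝ → Cn n, IsPiecewiseC1 γ₂ → MapsTo γ₂ (Icc 0 1) Ω → γ₂ 0 = y → γ₂ 1 = z →
      kobayashiDist Ω x z ≤ kobayashiLength Ω γ₁ + kobayashiLength Ω γ₂ := by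
    intro γ₁ h₁ hm₁ h10 h11 γ₂ h₂ hm₂ h20 h21
    set γ : ℝ → Cn n := fun t => if t ≤ 1 / 2 then γ₁ (2 * t) else γ₂ (2 * t - 1) with hγ
    have e1 : ∀ t ≤ (1 / 2 : ℝ), γ t = γ₁ (2 * t) := fun t ht => if_pos ht
    have e2 : ∀ t, (1 / 2 : ℝ) ≤ t → γ t = γ₂ (2 * t - 1) := by
      intro t ht
      rcases ht.lt_or_eq with h | h
      · exact if_neg (not_le.2 h)
      · rw [e1 t h.ge, ← h]; norm_num [h11, h20]
    have hlen : kobayashiLength Ω γ ≤ kobayashiLength Ω γ₁ + kobayashiLength Ω γ₂ := by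
      unfold kobayashiLength
      rw [setLIntegral_Icc_add_Icc (b := 1 / 2) (by norm_num) (by norm_num)]
      -- Open intervals are used because there the two curves agree near each point, so their
      -- derivatives agree; the endpoints are null.
      have step : ∀ (γ' : ℝ → Cn n) (u c : ℝ), (∀ t ∈ Ioo u (u + 1 / 2), γ t = γ' (2 * t - c)) →
          2 * u = c → ∫⁻ t in Icc u (u + 1 / 2), kobayashiMetric Ω (γ t) (deriv γ t) ≤
            ∫⁻ t in Icc (0 : ℝ) 1, kobayashiMetric Ω (γ' t) (deriv γ' t) := by
        intro γ' u c he hc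
        have himg : (fun t : ℝ => 2 * t - c) '' Ioo u (u + 1 / 2) = Ioo 0 1 := by
          ext s
          simp only [mem_image, mem_Ioo]
          constructor
          · rintro ⟨t, ht, rfl⟩; constructor <;> linarith [ht.1, ht.2]
          · intro hs; exact ⟨(s + c) / 2, ⟨by linarith [hs.1], by linarith [hs.2]⟩, by ring⟩
        have hA : ∀ s : ℝ, HasDerivAt (fun t : ℝ => 2 * t - c) 2 s := fun s => by
          simpa using ((hasDerivAt_id s).const_mul 2).sub_const c
        rw [← restrict_Ioo_eq_restrict_Icc, ← restrict_Ioo_eq_restrict_Icc, ← himg,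
          lintegral_image_eq_lintegral_abs_deriv_mul measurableSet_Ioo
          (fun s _ => (hA s).hasDerivWithinAt) (fun a _ b _ hab => by simpa using hab)]
        refine setLIntegral_mono' measurableSet_Ioo fun s hs => ?_
        have hev : γ =ᶠ[𝓝 s] fun t => γ' (2 * t - c) := by
          filter_upwards [isOpen_Ioo.mem_nhds hs] with t ht using he t ht
        have hd : deriv γ s = (2 : ℂ) • deriv γ' (2 * s - c) := by
          rw [hev.deriv_eq, deriv_comp_mul_left 2 (fun t => γ' (t - c)) s, deriv_comp_sub_const]
          rw [← Complex.coe_smul]; norm_num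
        rw [hd, he s hs]
        refine (kobayashiMetric_smul_le (by norm_num)).trans (le_of_eq ?_)
        congr 1
        rw [← ofReal_norm]; norm_num
      refine add_le_add ?_ ?_
      · have := step γ₁ 0 0 (fun t ht => by rw [e1 t (by linarith [ht.2]), sub_zero]) (by norm_num)
        simpa using this
      · have := step γ₂ (1 / 2) 1 (fun t ht => e2 t ht.1.le) (by norm_num)
        rwa [show (1 / 2 + 1 / 2 : ℝ) = 1 by norm_num] at this
    refine (kobayashiDist_le ?_ ?_ ?_ ?_).trans hlen
    · obtain ⟨N, t, hmono, ht0, ht1, hC⟩ := h₁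
      obtain ⟨M, s, smono, hs0, hs1, sC⟩ := h₂
      have htN : ∀ i ≤ N, t i ≤ 1 := fun i hi => ht1 ▸ hmono hi
      have hs0' : ∀ i, 0 ≤ s i := fun i => hs0 ▸ smono (Nat.zero_le i)
      -- Both subdivisions are compressed to half length. The two formulas agree at index `N`, where
      -- each gives 1/2.
      refine ⟨N + M, fun i => if i ≤ N then t i / 2 else (1 + s (i - N)) / 2, ?_, by simp [ht0], ?_, ?_⟩
      · intro i j hij
        simp only
        split_ifs with h3 h4 h4
        · linarith [hmono hij]
        · linarith [htN i h3, hs0' (j - N)]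
        · omega
        · linarith [smono (show i - N ≤ j - N by omega)]
      · by_cases hM : M = 0
        · subst hM; rw [hs0] at hs1; norm_num at hs1
        · simp only [show ¬ (N + M ≤ N) by omega, if_false, Nat.add_sub_cancel_left, hs1]; norm_num
      · intro i hi
        have htn : ∀ j, N ≤ j → (if j ≤ N then t j / 2 else (1 + s (j - N)) / 2) =
            (1 + s (j - N)) / 2 := by
          intro j hj
          split_ifs with h3
          · obtain rfl : j = N := le_antisymm h3 hj
            simp [ht1, hs0]
          · rfl
        by_cases hiN : i < N
        · simp only [hiN.le, if_true, show i + 1 ≤ N from hiN]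
          refine ((hC i hiN).comp (contDiff_const.mul contDiff_id : ContDiff ℝ 1
            fun r : ℝ => 2 * r).contDiffOn fun r hr => ?_).congr fun r hr => ?_
          · exact ⟨by linarith [hr.1], by linarith [hr.2]⟩
          · exact e1 r (by linarith [hr.2, htN (i + 1) hiN])
        · beta_reduce
          rw [htn i (by omega), htn (i + 1) (by omega), show i + 1 - N = i - N + 1 by omega]
          refine ((sC (i - N) (by omega)).comp ((contDiff_const.mul contDiff_id).sub
            contDiff_const : ContDiff ℝ 1 fun r : ℝ => 2 * r - 1).contDiffOn
              fun r hr => ?_).congr fun r hr => ?_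
          · have h3 := hr.1
            have h4 := hr.2
            simp only [id]
            constructor <;> linarith
          · exact e2 r (by linarith [hr.1, hs0' (i - N)])
    · intro t ht
      rcases le_total t (1 / 2) with h | h
      · rw [e1 t h]; exact hm₁ ⟨by linarith [ht.1], by linarith⟩
      · rw [e2 t h]; exact hm₂ ⟨by linarith, by linarith [ht.2]⟩
    · rw [e1 0 (by norm_num)]; simpa using h10
    · rw [e2 1 (by norm_num)]; norm_num [h21]
  unfold kobayashiDist
  simp only [ENNReal.iInf_add, ENNReal.add_iInf]
  exact le_iInf fun γ₂ => le_iInf fun h5 => le_iInf fun h6 => le_iInf fun h7 => le_iInf fun h8 =>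
    le_iInf fun γ₁ => le_iInf fun h1 => le_iInf fun h2 => le_iInf fun h3 => le_iInf fun h4 =>
    key γ₁ h1 h2 h3 h4 γ₂ h5 h6 h7 h8

end KobayashiBasics

/-! ### Supporting half spaces and lower bounds from `m`-convexity. -/

section LowerBounds

open Set Metric MeasureTheory Filter Topology

variable {n : ℕ} {Ω : Set (Cn n)} {m : ℝ}

theorem IsPreconnected.subset_of_disjoint_frontier {X : Type*} [TopologicalSpace X] {S U : Set X}
    (hS : IsPreconnected S) (hU : IsOpen U) (hne : (S ∩ U).Nonempty)
    (hd : Disjoint S (frontier U)) : S ⊆ U := by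
  refine hS.subset_of_closure_inter_subset hU hne fun y hy => ?_
  by_contra hyU
  exact disjoint_left.1 hd hy.2 ⟨hy.1, by rwa [hU.interior_eq]⟩

namespace IsMConvexDomain

theorem notMem_of_mem_frontier (h : IsMConvexDomain m Ω) {p : Cn n} (hp : p ∈ frontier Ω) :
    p ∉ Ω := by
  rw [h.isOpen.frontier_eq] at hp
  exact hp.2

theorem ball_bdryDist_subset (h : IsMConvexDomain m Ω) {x : Cn n} (hx : x ∈ Ω) :
    ball x (bdryDist Ω x) ⊆ Ω := by
  rcases le_or_gt (bdryDist Ω x) 0 with h0 | h0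
  · simp [ball_eq_empty.2 h0]
  refine (convex_ball x _).isPreconnected.subset_of_disjoint_frontier h.isOpen
    ⟨x, mem_ball_self h0, hx⟩ disjoint_ball_infDist

/-- A connected line avoiding the boundary would stay in the bounded set Ω. Nonemptiness keeps
`bdryDistDir` from taking the default value 0 of `infDist` to the empty set. -/
theorem exists_frontier_of_line (h : IsMConvexDomain m Ω) {x v : Cn n} (hx : x ∈ Ω) (hv : v ≠ 0) :
    (frontier Ω ∩ range fun c : ℂ => x + c • v).Nonempty := by
  by_contra hne
  rw [not_nonempty_iff_eq_empty, ← disjoint_iff_inter_eq_empty] at hne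
  have hpre : IsPreconnected (range fun c : ℂ => x + c • v) :=
    isPreconnected_range (by fun_prop)
  have hsub := hpre.subset_of_disjoint_frontier h.isOpen ⟨x, ⟨0, by simp⟩, hx⟩ hne.symm
  obtain ⟨R, hR⟩ := h.isBounded.exists_norm_le
  have hv' : 0 < ‖v‖ := norm_pos_iff.2 hv
  have h1 := hR _ (hsub ⟨(((R + ‖x‖ + 1) / ‖v‖ : ℝ) : ℂ), rfl⟩)
  have h2 : ‖((((R + ‖x‖ + 1) / ‖v‖ : ℝ) : ℂ)) • v‖ = |R + ‖x‖ + 1| := by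
    rw [norm_smul, Complex.norm_real, Real.norm_eq_abs, abs_div, abs_of_pos hv',
      div_mul_cancel₀ _ hv'.ne']
  have h3 := norm_sub_norm_le (((((R + ‖x‖ + 1) / ‖v‖ : ℝ) : ℂ)) • v) (-x)
  rw [h2, norm_neg, sub_neg_eq_add, add_comm _ x] at h3
  have h4 := le_abs_self (R + ‖x‖ + 1)
  linarith

theorem frontier_nonempty (h : IsMConvexDomain m Ω) (hn : 0 < n) : (frontier Ω).Nonempty := by
  obtain ⟨x, hx⟩ := h.nonempty
  have : (EuclideanSpace.single (⟨0, hn⟩ : Fin n) (1 : ℂ)) ≠ 0 := by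
    intro h0
    have := congrArg norm h0
    simp at this
  exact (h.exists_frontier_of_line hx this).mono inter_subset_left

theorem exists_nearest (h : IsMConvexDomain m Ω) (hn : 0 < n) (x : Cn n) :
    ∃ p ∈ frontier Ω, bdryDist Ω x = dist x p :=
  isClosed_frontier.exists_infDist_eq_dist (h.frontier_nonempty hn) x

theorem bdryDist_pos (h : IsMConvexDomain m Ω) (hn : 0 < n) {x : Cn n} (hx : x ∈ Ω) : 0 < bdryDist Ω x := by
  refine (infDist_pos_iff_notMem_closure (h.frontier_nonempty hn)).1 ?_
  rw [isClosed_frontier.closure_eq]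
  exact fun hf => h.notMem_of_mem_frontier hf hx

/-- A unit-norm complex functional supporting `Ω` at a boundary point. -/
theorem exists_support (h : IsMConvexDomain m Ω) {p : Cn n} (hp : p ∈ frontier Ω) :
    ∃ L : Cn n →L[ℂ] ℂ, ‖L‖ = 1 ∧
    (∀ y ∈ Ω, 0 < (L y - L p).re) ∧ ∀ y ∈ Ω, bdryDist Ω y ≤ (L y - L p).re := by
  obtain ⟨f, hf⟩ := RCLike.geometric_hahn_banach_open_point (𝕜 := ℂ) h.convex h.isOpen
    (h.notMem_of_mem_frontier hp)
  have hf0 : f ≠ 0 := by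
    rintro rfl
    obtain ⟨x, hx⟩ := h.nonempty
    simpa using hf x hx
  have hfn : 0 < ‖f‖ := norm_pos_iff.2 hf0
  set L : Cn n →L[ℂ] ℂ := ((-(‖f‖⁻¹) : ℝ) : ℂ) • f with hL
  have hLre : ∀ y, (L y - L p).re = ‖f‖⁻¹ * ((f p).re - (f y).re) := by
    intro y
    simp only [hL, smul_apply, smul_eq_mul, Complex.sub_re, Complex.re_ofReal_mul]
    ring
  have hpos : ∀ y ∈ Ω, 0 < (L y - L p).re := by
    intro y hy
    rw [hLre]
    have := hf y hy
    simp only [RCLike.re_to_complex] at this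
    exact mul_pos (inv_pos.2 hfn) (by linarith)
  have hL1 : ‖L‖ = 1 := by
    rw [hL, norm_smul, Complex.norm_real, norm_neg, norm_inv, norm_norm, inv_mul_cancel₀ hfn.ne']
  refine ⟨L, hL1, hpos, fun y hy => ?_⟩
  set u := (L y - L p).re with hu
  by_contra! hlt
  have hd : 0 < bdryDist Ω y := (hpos y hy).trans hlt
  -- The ball of radius `bdryDist Ω y` about `y` stays in the half space, so `L` cannot fall by more
  -- than `u` within it. As `u` is assumed smaller than that radius, this contradicts ‖L‖ = 1.
  have key : ‖L‖ ≤ u / bdryDist Ω y := by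
    refine L.opNorm_le_bound (div_pos (hpos y hy) hd).le fun v => ?_
    by_cases hLv : L v = 0
    · rw [hLv, norm_zero]
      exact mul_nonneg (div_pos (hpos y hy) hd).le (norm_nonneg _)
    have hv : 0 < ‖v‖ := norm_pos_iff.2 fun h0 => hLv (by rw [h0, map_zero])
    have hLv' : 0 < ‖L v‖ := norm_pos_iff.2 hLv
    by_contra! hcon
    -- the point of `Ω` at distance `r` from `y` in the steepest direction
    rw [div_mul_eq_mul_div, div_lt_iff₀ hd] at hcon
    set r : ℝ := u / ‖L v‖ with hr
    have hr0 : 0 < r := div_pos (hpos y hy) hLv'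
    set c : ℂ := (r : ℂ) * ((starRingEnd ℂ) (L v) / ‖L v‖) with hc
    have hcn : ‖c‖ = r := by
      rw [hc, norm_mul, Complex.norm_real, Real.norm_of_nonneg hr0.le, norm_div, RCLike.norm_conj,
        Complex.norm_real, norm_norm, div_self hLv'.ne', mul_one]
    have hmem : y - c • v ∈ Ω := by
      refine h.ball_bdryDist_subset hy ?_
      rw [mem_ball, dist_eq_norm, sub_sub_cancel_left, norm_neg, norm_smul, hcn, hr,
        div_mul_eq_mul_div, div_lt_iff₀ hLv', mul_comm (bdryDist Ω y)]
      exact hcon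
    have h1 := hpos _ hmem
    have h2 : L (c • v) = (u : ℂ) := by
      rw [map_smul, smul_eq_mul, hc, mul_assoc, div_mul_eq_mul_div, mul_comm ((starRingEnd ℂ) _),
        Complex.mul_conj, Complex.normSq_eq_norm_sq, hr]
      have : (‖L v‖ : ℂ) ≠ 0 := by exact_mod_cast hLv'.ne'
      push_cast
      field_simp
    rw [map_sub, h2, sub_right_comm, Complex.sub_re, Complex.ofReal_re, ← hu, sub_self] at h1
    exact lt_irrefl _ h1
  rw [hL1, le_div_iff₀ hd, one_mul] at key
  exact absurd hlt (not_lt.2 key)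

/-- A unit-norm complex functional supporting `Ω` at a boundary point nearest to `x`. -/
theorem exists_support_nearest (h : IsMConvexDomain m Ω) (hn : 0 < n) {x : Cn n} (hx : x ∈ Ω) :
    ∃ (L : Cn n →L[ℂ] ℂ) (a : ℂ), ‖L‖ = 1 ∧ (∀ y ∈ Ω, 0 < (L y - a).re) ∧
      (∀ y ∈ Ω, bdryDist Ω y ≤ (L y - a).re) ∧ (L x - a).re = bdryDist Ω x := by
  obtain ⟨p, hp, hxp⟩ := h.exists_nearest hn x
  obtain ⟨L, hL1, hpos, hle⟩ := h.exists_support hp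
  refine ⟨L, L p, hL1, hpos, hle, le_antisymm ?_ (hle x hx)⟩
  rw [hxp, dist_eq_norm, ← map_sub]
  refine (Complex.re_le_norm _).trans ((L.le_opNorm _).trans ?_)
  rw [hL1, one_mul]

/-- The Kobayashi metric of an `m`-convex domain is at least a multiple of `|v| / δ(z)^(1/m)`. -/
theorem exists_le_kobayashiMetric (h : IsMConvexDomain m Ω) (hn : 0 < n) :
    ∃ c : ℝ, 0 < c ∧ ∀ z ∈ Ω, ∀ v,
    ENNReal.ofReal (c * ‖v‖ / bdryDist Ω z ^ (1 / m)) ≤ kobayashiMetric Ω z v := by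
  obtain ⟨C, hC, hle⟩ := h.exists_bound
  refine ⟨1 / (4 * C), by positivity, fun z hz v => ?_⟩
  by_cases hv : v = 0
  · simp [hv]
  have hd := h.bdryDist_pos hn hz
  have hdm : 0 < bdryDist Ω z ^ (1 / m) := Real.rpow_pos_of_pos hd _
  -- The factor 2 makes the inequality strict, which yields a boundary point `z + c • v` with |c||v|
  -- < 2Cδ^(1/m). The half space supporting Ω there bounds the metric below by 1 / (2|c|), whence
  -- the constant 1 / (4C).
  have hlt : infDist z (frontier Ω ∩ range fun c : ℂ => z + c • v) <
      2 * C * bdryDist Ω z ^ (1 / m) := (hle z hz v hv).trans_lt (by nlinarith [mul_pos hC hdm])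
  obtain ⟨_, ⟨hp, c, rfl⟩, hdist⟩ := (infDist_lt_iff (h.exists_frontier_of_line hz hv)).1 hlt
  obtain ⟨L, -, hpos, -⟩ := h.exists_support hp
  refine le_trans (ENNReal.ofReal_le_ofReal ?_) (le_kobayashiMetric_of_halfSpace hpos z v)
  have h1 := hpos z hz
  have h2 : (L z - L (z + c • v)).re ≤ ‖c‖ * ‖L v‖ := by
    refine (Complex.re_le_norm _).trans (le_of_eq ?_)
    rw [← map_sub, sub_add_cancel_left, map_neg, norm_neg, map_smul, norm_smul]
  have h3 : 0 < ‖L v‖ := by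
    by_contra! h0
    nlinarith [norm_nonneg c]
  rw [dist_eq_norm, sub_add_cancel_left, norm_neg, norm_smul] at hdist
  rw [div_le_div_iff₀ hdm (by positivity)]
  have hv' : 0 < ‖v‖ := norm_pos_iff.2 hv
  calc 1 / (4 * C) * ‖v‖ * (2 * (L z - L (z + c • v)).re)
      ≤ 1 / (4 * C) * ‖v‖ * (2 * (‖c‖ * ‖L v‖)) := by gcongr
    _ = (‖c‖ * ‖v‖) * ‖L v‖ / (2 * C) := by ring
    _ ≤ (2 * C * bdryDist Ω z ^ (1 / m)) * ‖L v‖ / (2 * C) := by gcongr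
    _ = ‖L v‖ * bdryDist Ω z ^ (1 / m) := by field_simp

/-- The logarithm of the distance to a supporting hyperplane grows at most as fast as the length. -/
theorem enorm_half_log_sub_le {L : Cn n →L[ℂ] ℂ} {a : ℂ} (hL : ∀ y ∈ Ω, 0 < (L y - a).re)
    {γ : ℝ → Cn n} (hγ : IsPiecewiseC1 γ) (hm : MapsTo γ (Icc 0 1) Ω) {s t : ℝ} (hs : 0 ≤ s)
    (hst : s ≤ t) (ht : t ≤ 1) :
    ‖1 / 2 * Real.log ((L (γ t) - a).re) - 1 / 2 * Real.log ((L (γ s) - a).re)‖ₑ ≤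
      ∫⁻ r in Icc s t, kobayashiMetric Ω (γ r) (deriv γ r) := by
  have hd : ∀ z : Cn n, HasFDerivAt (fun z => (L z - a).re)
      (Complex.reCLM.comp (L.restrictScalars ℝ)) z := fun z =>
    Complex.reCLM.hasFDerivAt.comp z ((L.restrictScalars ℝ).hasFDerivAt.sub_const a)
  have hc : ContDiff ℝ 1 fun z : Cn n => (L z - a).re :=
    Complex.reCLM.contDiff.comp ((L.restrictScalars ℝ).contDiff.sub contDiff_const)
  have hmem : ∀ r ∈ Icc s t, γ r ∈ Ω := fun r hr => hm ⟨hs.trans hr.1, hr.2.trans ht⟩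
  refine enorm_sub_le_lintegral_kobayashiMetric (h := fun z => 1 / 2 * Real.log ((L z - a).re)) hγ hs
    hst ht (fun r hr => ?_) fun r hr v => ?_
  · exact contDiffAt_const.mul (hc.contDiffAt.log (hL _ (hmem r hr)).ne')
  · have hpos := hL _ (hmem r hr)
    refine le_trans ?_ (le_kobayashiMetric_of_halfSpace hL (γ r) v)
    rw [(((hd (γ r)).log hpos.ne').const_mul (1 / 2)).fderiv, ← ofReal_norm]
    refine ENNReal.ofReal_le_ofReal ?_
    simp only [smul_apply, ContinuousLinearMap.comp_apply, smul_eq_mul, norm_mul,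
      ContinuousLinearMap.coe_restrictScalars', Complex.reCLM_apply]
    rw [norm_inv, Real.norm_of_nonneg hpos.le, Real.norm_eq_abs (L v).re, le_div_iff₀ (by positivity)]
    have := Complex.abs_re_le_norm (L v)
    rw [show ‖(1 / 2 : ℝ)‖ = 1 / 2 by norm_num]
    field_simp
    exact this

/-- For a half space supporting Ω at a boundary point nearest to `x`, the distance to the hyperplane
equals the depth at `x` and dominates the depth at `y`. -/
theorem half_log_bdryDist_sub_le (h : IsMConvexDomain m Ω) (hn : 0 < n) {x y : Cn n} (hx : x ∈ Ω)
    (hy : y ∈ Ω) :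
    ENNReal.ofReal (1 / 2 * Real.log (bdryDist Ω y) - 1 / 2 * Real.log (bdryDist Ω x)) ≤
      kobayashiDist Ω x y := by
  obtain ⟨L, a, -, hpos, hle, hxe⟩ := h.exists_support_nearest hn hx
  refine le_kobayashiDist fun γ hγ hm h0 h1 => ?_
  refine le_trans ?_ (enorm_half_log_sub_le hpos hγ hm le_rfl zero_le_one le_rfl)
  rw [h0, h1, hxe, ← ofReal_norm]
  refine ENNReal.ofReal_le_ofReal (le_trans ?_ (le_abs_self _))
  have := Real.log_le_log (h.bdryDist_pos hn hy) (hle y hy)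
  linarith

theorem exists_bdryDist_le (h : IsMConvexDomain m Ω) (hn : 0 < n) :
    ∃ D : ℝ, 0 < D ∧ ∀ z ∈ Ω, bdryDist Ω z ≤ D := by
  obtain ⟨p, hp⟩ := h.frontier_nonempty hn
  obtain ⟨R, hR0, hR⟩ := h.isBounded.exists_pos_norm_le
  refine ⟨R + ‖p‖, by positivity, fun z hz => (infDist_le_dist_of_mem hp).trans ?_⟩
  rw [dist_eq_norm]
  exact (norm_sub_le _ _).trans (by linarith [hR z hz])

/-- Depths are bounded, so the metric dominates a multiple of the Euclidean norm; a norming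
functional turns this into a bound on distances. It yields continuity and injectivity of isometries.
-/
theorem exists_norm_sub_le_kobayashiDist (h : IsMConvexDomain m Ω) (hn : 0 < n) :
    ∃ c : ℝ, 0 < c ∧ ∀ x ∈ Ω, ∀ y ∈ Ω,
    ENNReal.ofReal (c * ‖x - y‖) ≤ kobayashiDist Ω x y := by
  obtain ⟨c, hc, hK⟩ := h.exists_le_kobayashiMetric hn
  obtain ⟨D, hD, hDle⟩ := h.exists_bdryDist_le hn
  have hm1 := h.one_lt
  have hDm : 0 < D ^ (1 / m) := Real.rpow_pos_of_pos hD _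
  refine ⟨c / D ^ (1 / m), by positivity, fun x hx y hy => le_kobayashiDist fun γ hγ hm h0 h1 => ?_⟩
  by_cases hxy : y - x = 0
  · rw [← norm_neg, neg_sub, hxy]; simp
  obtain ⟨L, hL1, hLe⟩ := exists_dual_vector ℝ (y - x) (norm_ne_zero_iff.2 hxy)
  have hcd : ContDiff ℝ 1 fun z => c / D ^ (1 / m) * L z := contDiff_const.mul L.contDiff
  refine le_trans ?_ (enorm_sub_le_lintegral_kobayashiMetric hγ le_rfl zero_le_one le_rfl
    (fun t _ => hcd.contDiffAt) fun t ht v => ?_)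
  · rw [h0, h1, ← mul_sub, ← map_sub, hLe, ← ofReal_norm, norm_sub_rev x y]
    exact ENNReal.ofReal_le_ofReal (le_abs_self _)
  · refine le_trans ?_ (hK _ (hm ht) v)
    rw [(L.hasFDerivAt.const_mul (c / D ^ (1 / m))).fderiv, ← ofReal_norm]
    refine ENNReal.ofReal_le_ofReal ?_
    rw [smul_apply, norm_smul, Real.norm_of_nonneg (by positivity), div_mul_eq_mul_div]
    have hd := h.bdryDist_pos hn (hm ht)
    have h2 : ‖L v‖ ≤ ‖v‖ := by simpa [hL1] using L.le_opNorm v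
    have h3 := hDle _ (hm ht)
    have h4 : 0 < 1 / m := by positivity
    gcongr

/-- The cost of moving away from `x`, in terms of the depth of `x`. -/
theorem leave_le_lintegral (h : IsMConvexDomain m Ω) (hn : 0 < n) :
    ∃ B : ℝ, 0 < B ∧ ∀ γ : ℝ → Cn n, IsPiecewiseC1 γ →
    MapsTo γ (Icc 0 1) Ω → ∀ T ∈ Icc (0 : ℝ) 1, γ T ≠ γ 0 →
    ENNReal.ofReal (m / 2 * Real.log (‖γ T - γ 0‖ / B) - 1 / 2 * Real.log (bdryDist Ω (γ 0))) ≤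
      ∫⁻ t in Icc 0 T, kobayashiMetric Ω (γ t) (deriv γ t) := by
  obtain ⟨c, hc, hK⟩ := h.exists_le_kobayashiMetric hn
  have hm1 := h.one_lt
  have hm0 : 0 < m := by linarith
  refine ⟨m / (2 * c), by positivity, fun γ hγ hm T hT hne => ?_⟩
  -- Chosen so that c B = m/2: where |γ - x| ≥ B δ^(1/m), the metric is at least (m/2)|v| / |γ - x|,
  -- which controls (m/2) log|γ - x|.
  set B := m / (2 * c) with hB
  have hB0 : 0 < B := by positivity
  set x := γ 0 with hx
  have hxΩ : x ∈ Ω := hm ⟨le_rfl, zero_le_one⟩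
  obtain ⟨L, a, -, hpos, hle, hxe⟩ := h.exists_support_nearest hn hxΩ
  set u : ℝ → ℝ := fun t => (L (γ t) - a).re with hu
  have hsubT : Icc 0 T ⊆ Icc (0 : ℝ) 1 := Icc_subset_Icc_right hT.2
  have hupos : ∀ t ∈ Icc (0 : ℝ) T, 0 < u t := fun t ht => hpos _ (hm (hsubT ht))
  have hγc : ContinuousOn γ (Icc 0 T) := hγ.continuousOn.mono hsubT
  have huc : ContinuousOn u (Icc 0 T) :=
    Complex.continuous_re.comp_continuousOn ((L.continuous.comp_continuousOn hγc).sub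
      continuousOn_const)
  have hum : ContinuousOn (fun t => B * u t ^ (1 / m)) (Icc 0 T) :=
    continuousOn_const.mul (huc.rpow_const fun t ht => Or.inl (hupos t ht).ne')
  have hρc : ContinuousOn (fun t => ‖γ t - x‖) (Icc 0 T) := (hγc.sub continuousOn_const).norm
  -- the estimate as long as the displacement is controlled by the depth
  have hfirst : ∀ t ∈ Icc (0 : ℝ) T, γ t ≠ x → ‖γ t - x‖ ≤ B * u t ^ (1 / m) →
      ENNReal.ofReal (m / 2 * Real.log (‖γ t - x‖ / B) - 1 / 2 * Real.log (bdryDist Ω x)) ≤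
      ∫⁻ r in Icc 0 t, kobayashiMetric Ω (γ r) (deriv γ r) := by
    intro t ht htx hle'
    refine le_trans ?_ (enorm_half_log_sub_le hpos hγ hm le_rfl ht.1 (ht.2.trans hT.2))
    rw [← hx, hxe, ← ofReal_norm]
    refine ENNReal.ofReal_le_ofReal (le_trans ?_ (le_abs_self _))
    have h1 : 0 < ‖γ t - x‖ := norm_pos_iff.2 (sub_ne_zero.2 htx)
    have h2 : Real.log (‖γ t - x‖ / B) ≤ 1 / m * Real.log (u t) := by
      rw [← Real.log_rpow (hupos t ht)]
      refine Real.log_le_log (by positivity) ?_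
      rw [div_le_iff₀ hB0, mul_comm]
      exact hle'
    have h3 : m / 2 * Real.log (‖γ t - x‖ / B) ≤ m / 2 * (1 / m * Real.log (u t)) := by gcongr
    have h4 : m / 2 * (1 / m * Real.log (u t)) = 1 / 2 * Real.log (u t) := by field_simp
    rw [h4] at h3
    linarith
  -- The curve is cut at the last time the displacement is at most B u^(1/m). Up to then growth of
  -- log u pays for the displacement; afterwards the metric bound does. The two contributions add up
  -- to the claim without any loss at the cut.
  set A : Set ℝ := {t ∈ Icc (0 : ℝ) T | ‖γ t - x‖ ≤ B * u t ^ (1 / m)} with hA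
  have hAc : IsCompact A := isCompact_Icc.of_isClosed_subset
    (isClosed_Icc.isClosed_le hρc hum) fun t ht => ht.1
  have h0A : (0 : ℝ) ∈ A := by
    refine ⟨⟨le_rfl, hT.1⟩, ?_⟩
    rw [← hx, sub_self, norm_zero]
    exact mul_nonneg hB0.le (Real.rpow_nonneg (hupos 0 ⟨le_rfl, hT.1⟩).le _)
  obtain ⟨t₁, ⟨ht₁, ht₁le⟩, hmax⟩ := hAc.exists_isGreatest ⟨0, h0A⟩
  rcases ht₁.2.eq_or_lt with heq | hlt
  · subst heq
    exact hfirst t₁ ht₁ hne ht₁le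
  have hgt : ∀ t ∈ Ioc t₁ T, B * u t ^ (1 / m) < ‖γ t - x‖ := by
    intro t ht
    by_contra! hcon
    exact absurd (hmax ⟨⟨ht₁.1.trans ht.1.le, ht.2⟩, hcon⟩) (not_le.2 ht.1)
  have hge : ∀ t ∈ Icc t₁ T, B * u t ^ (1 / m) ≤ ‖γ t - x‖ := by
    have hcl : closure (Ioc t₁ T) = Icc t₁ T := closure_Ioc hlt.ne
    have hsub : Icc t₁ T ⊆ Icc 0 T := Icc_subset_Icc_left ht₁.1
    intro t ht
    rw [← hcl] at ht
    exact ContinuousWithinAt.closure_le ht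
      ((hum t (hsub (hcl ▸ ht))).mono (Ioc_subset_Icc_self.trans hsub))
      ((hρc t (hsub (hcl ▸ ht))).mono (Ioc_subset_Icc_self.trans hsub)) fun s hs => (hgt s hs).le
  have hupos' : ∀ t ∈ Icc t₁ T, 0 < B * u t ^ (1 / m) := fun t ht =>
    mul_pos hB0 (Real.rpow_pos_of_pos (hupos t ⟨ht₁.1.trans ht.1, ht.2⟩) _)
  have hρpos : ∀ t ∈ Icc t₁ T, 0 < ‖γ t - x‖ := fun t ht => (hupos' t ht).trans_le (hge t ht)
  have hρ₁ := hρpos t₁ ⟨le_rfl, hlt.le⟩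
  have hsecond : ‖m / 2 * Real.log ‖γ T - x‖ - m / 2 * Real.log ‖γ t₁ - x‖‖ₑ ≤
      ∫⁻ r in Icc t₁ T, kobayashiMetric Ω (γ r) (deriv γ r) := by
    refine enorm_sub_le_lintegral_kobayashiMetric (h := fun z => m / 2 * Real.log ‖z - x‖) hγ ht₁.1
      hlt.le hT.2 (fun r hr => ?_) fun r hr v => ?_
    · have hr0 : γ r - x ≠ 0 := norm_pos_iff.1 (hρpos r hr)
      exact contDiffAt_const.mul (((contDiffAt_norm ℝ hr0).comp (γ r)
        (contDiffAt_id.sub contDiffAt_const)).log (hρpos r hr).ne')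
    · have hr0 : γ r - x ≠ 0 := norm_pos_iff.1 (hρpos r hr)
      have hrΩ : γ r ∈ Ω := hm ⟨ht₁.1.trans hr.1, hr.2.trans hT.2⟩
      refine le_trans ?_ (hK _ hrΩ v)
      have hdn : DifferentiableAt ℝ (fun z => ‖z - x‖) (γ r) :=
        ((contDiffAt_norm ℝ hr0 (n := 1)).comp (γ r)
          (contDiffAt_id.sub contDiffAt_const)).differentiableAt one_ne_zero
      have hlip : LipschitzWith 1 (fun z : Cn n => ‖z - x‖) := by
        refine LipschitzWith.of_dist_le_mul fun z w => ?_
        rw [NNReal.coe_one, one_mul, Real.dist_eq, dist_eq_norm]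
        refine (abs_norm_sub_norm_le _ _).trans (le_of_eq ?_)
        congr 1; abel
      have hfn : ‖fderiv ℝ (fun z => ‖z - x‖) (γ r) v‖ ≤ ‖v‖ := by
        refine (ContinuousLinearMap.le_opNorm _ v).trans ?_
        have := norm_fderiv_le_of_lipschitz ℝ hlip (x₀ := γ r)
        rw [NNReal.coe_one] at this
        nlinarith [norm_nonneg v]
      rw [((hdn.hasFDerivAt.log (hρpos r hr).ne').const_mul (m / 2)).fderiv, ← ofReal_norm]
      refine ENNReal.ofReal_le_ofReal ?_
      rw [smul_apply, smul_apply, norm_smul, norm_smul,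
        Real.norm_of_nonneg (by positivity : 0 ≤ m / 2), norm_inv, norm_norm]
      have hδ := h.bdryDist_pos hn hrΩ
      have hδm : 0 < bdryDist Ω (γ r) ^ (1 / m) := Real.rpow_pos_of_pos hδ _
      have h5 : B * bdryDist Ω (γ r) ^ (1 / m) ≤ ‖γ r - x‖ := by
        refine le_trans ?_ (hge r hr)
        have := hle _ hrΩ
        gcongr
      calc m / 2 * (‖γ r - x‖⁻¹ * ‖fderiv ℝ (fun z => ‖z - x‖) (γ r) v‖)
          ≤ m / 2 * ((B * bdryDist Ω (γ r) ^ (1 / m))⁻¹ * ‖v‖) := by gcongr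
        _ = c * ‖v‖ / bdryDist Ω (γ r) ^ (1 / m) := by rw [hB]; field_simp
  rw [setLIntegral_Icc_add_Icc ht₁.1 hlt.le]
  refine le_trans ?_ (add_le_add (hfirst t₁ ht₁ (sub_ne_zero.1 (norm_pos_iff.1 hρ₁)) ht₁le) hsecond)
  rw [← ofReal_norm]
  refine le_trans (ENNReal.ofReal_le_ofReal ?_) ENNReal.ofReal_add_le
  refine le_trans (le_of_eq ?_) (add_le_add_right (le_abs_self _) _)
  rw [Real.log_div (hρpos T ⟨hlt.le, le_rfl⟩).ne' hB0.ne', Real.log_div hρ₁.ne' hB0.ne']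
  ring

/-- Lower bound for the Kobayashi distance of two points in terms of their depths and their
Euclidean distance. -/
theorem exists_le_kobayashiDist (h : IsMConvexDomain m Ω) (hn : 0 < n) :
    ∃ C : ℝ, ∀ x ∈ Ω, ∀ y ∈ Ω, x ≠ y →
    ENNReal.ofReal (m * Real.log ‖x - y‖ - 1 / 2 * Real.log (bdryDist Ω x) -
      1 / 2 * Real.log (bdryDist Ω y) - C) ≤ kobayashiDist Ω x y := by
  obtain ⟨B, hB, hleave⟩ := h.leave_le_lintegral hn
  have hm0 : 0 < m := by linarith [h.one_lt]
  refine ⟨m * Real.log (2 * B), fun x hx y hy hxy => le_kobayashiDist fun γ hγ hm h0 h1 => ?_⟩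
  have hr : 0 < ‖x - y‖ := norm_pos_iff.2 (sub_ne_zero.2 hxy)
  -- At time `T` the curve has moved at least half of |x - y| away from both ends. The cost of
  -- leaving is applied to `γ` on `[0, T]` and to its reverse on the remaining piece, each
  -- contributing m/2 times the logarithm.
  obtain ⟨T, hT, hTr⟩ : ∃ T ∈ Icc (0 : ℝ) 1, ‖γ T - x‖ = ‖x - y‖ / 2 := by
    have hc : ContinuousOn (fun t => ‖γ t - x‖) (Icc 0 1) :=
      (hγ.continuousOn.sub continuousOn_const).norm
    refine intermediate_value_Icc zero_le_one hc ⟨?_, ?_⟩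
    · simp only [h0, sub_self, norm_zero]; positivity
    · simp only [h1, norm_sub_rev y x]; linarith
  have hTy : ‖x - y‖ / 2 ≤ ‖γ T - y‖ := by
    have := norm_sub_le_norm_sub_add_norm_sub x (γ T) y
    rw [norm_sub_rev x (γ T), hTr] at this
    linarith
  have hpx : 0 < ‖γ T - x‖ := by rw [hTr]; positivity
  have hpy : 0 < ‖γ T - y‖ := by linarith
  have e1 := hleave γ hγ hm T hT (by rw [h0]; exact sub_ne_zero.1 (norm_pos_iff.1 hpx))
  have e2 := hleave _ hγ.reverse (fun t ht => hm ⟨by linarith [ht.2], by linarith [ht.1]⟩) (1 - T)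
    ⟨by linarith [hT.2], by linarith [hT.1]⟩ (by
      simp only [sub_sub_cancel, sub_zero, h1]
      exact sub_ne_zero.1 (norm_pos_iff.1 hpy))
  simp only [sub_sub_cancel, sub_zero, h1] at e2
  rw [h0] at e1
  have e3 := lintegral_kobayashiMetric_reverse_le (Ω := Ω) γ T 1
  rw [sub_self] at e3
  unfold kobayashiLength
  rw [setLIntegral_Icc_add_Icc hT.1 hT.2]
  refine le_trans ?_ (add_le_add e1 (e2.trans e3))
  refine le_trans (ENNReal.ofReal_le_ofReal ?_) ENNReal.ofReal_add_le
  have l1 : Real.log (‖γ T - x‖ / B) = Real.log ‖x - y‖ - Real.log (2 * B) := by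
    rw [hTr, div_div, Real.log_div hr.ne' (by positivity)]
  have l2 : Real.log ‖x - y‖ - Real.log (2 * B) ≤ Real.log (‖γ T - y‖ / B) := by
    rw [← Real.log_div hr.ne' (by positivity), ← div_div]
    exact Real.log_le_log (by positivity) (by gcongr)
  rw [l1]
  have l3 := mul_le_mul_of_nonneg_left l2 (by positivity : 0 ≤ m / 2)
  linarith

end IsMConvexDomain

end LowerBounds

/-! ### Normals of convex domains and the Dini condition at dyadic scales. -/

section DiniGeometry

open Set Metric MeasureTheory Filter Topology
open scoped RealInnerProductSpace

variable {n : ℕ} {Ω : Set (Cn n)} {m : ℝ}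

theorem inner_realGradient (r : Cn n → ℝ) (x v : Cn n) :
    ⟪realGradient r x, v⟫ = fderiv ℝ r x v := by
  have hv : v = ∑ j, ((v j).re • EuclideanSpace.single j (1 : ℂ) +
      (v j).im • EuclideanSpace.single j Complex.I) := by
    ext i
    simp only [PiLp.add_apply, PiLp.smul_apply, WithLp.ofLp_sum, Finset.sum_apply]
    rw [Finset.sum_eq_single i]
    · simp
    · intro j _ hj
      simp [hj.symm]
    · simp
  conv_rhs => rw [hv]
  rw [map_sum, PiLp.inner_apply]
  refine Finset.sum_congr rfl fun j _ => ?_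
  rw [map_add, map_smul, map_smul, Complex.inner]
  simp [realGradient]

theorem norm_unitNormal {r : Cn n → ℝ} {x : Cn n} (h : fderiv ℝ r x ≠ 0) :
    0 < ‖realGradient r x‖ ∧ ‖unitNormal r x‖ = 1 := by
  have h0 : 0 < ‖realGradient r x‖ := by
    refine norm_pos_iff.2 fun h0 => h ?_
    ext v
    rw [← inner_realGradient, h0, inner_zero_left]; rfl
  refine ⟨h0, ?_⟩
  rw [unitNormal, norm_smul, norm_inv, norm_norm, inv_mul_cancel₀ h0.ne']

theorem inner_unitNormal (r : Cn n → ℝ) (x v : Cn n) :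
    ⟪unitNormal r x, v⟫ = ‖realGradient r x‖⁻¹ * fderiv ℝ r x v := by
  rw [unitNormal, real_inner_smul_left, inner_realGradient]

namespace IsC1DefiningFunction

variable {U : Set (Cn n)} {r : Cn n → ℝ}

theorem hasFDerivAt (hr : IsC1DefiningFunction Ω U r) (hU : IsOpen U) {p : Cn n} (hp : p ∈ U) :
    HasFDerivAt r (fderiv ℝ r p) p :=
  ((hr.contDiffOn.contDiffAt (hU.mem_nhds hp)).differentiableAt one_ne_zero).hasFDerivAt

theorem eq_zero (hr : IsC1DefiningFunction Ω U r) (hU : IsOpen U) (hΩ : IsOpen Ω) {p : Cn n}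
    (hp : p ∈ U) (hpf : p ∈ frontier Ω) : r p = 0 := by
  have hpΩ : p ∉ Ω := by rw [hΩ.frontier_eq] at hpf; exact hpf.2
  refine le_antisymm ?_ ?_
  · by_contra! hpos
    have hc : ContinuousAt r p := (hr.hasFDerivAt hU hp).continuousAt
    have hev : ∀ᶠ y in 𝓝 p, 0 < r y ∧ y ∈ U :=
      (hc.eventually (lt_mem_nhds hpos)).and (hU.mem_nhds hp)
    obtain ⟨y, hy, hyΩ⟩ := mem_closure_iff_nhds.1 (frontier_subset_closure hpf) _ hev
    have : y ∈ {x ∈ U | r x < 0} := hr.inter_eq ▸ (⟨hyΩ, hy.2⟩ : y ∈ Ω ∩ U)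
    exact lt_asymm this.2 hy.1
  · by_contra! hneg
    have : p ∈ Ω ∩ U := by rw [hr.inter_eq]; exact ⟨hp, hneg⟩
    exact hpΩ this.1

/-- Tangent planes support a convex set: the segment from `p` to a point of Ω enters Ω at once, so
`r` has nonpositive slope along it. -/
theorem fderiv_sub_nonpos (hr : IsC1DefiningFunction Ω U r) (hU : IsOpen U) (hΩ : IsOpen Ω)
    (hc : Convex ℝ Ω) {p : Cn n} (hp : p ∈ U) (hpf : p ∈ frontier Ω) {y : Cn n}
    (hy : y ∈ closure Ω) : fderiv ℝ r p (y - p) ≤ 0 := by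
  refine closure_minimal (s := Ω) (t := {y | fderiv ℝ r p (y - p) ≤ 0}) ?_
    (isClosed_le (by fun_prop) continuous_const) hy
  intro y hy
  have h0 := hr.eq_zero hU hΩ hp hpf
  have hd : HasDerivAt (fun t : ℝ => r (p + t • (y - p))) (fderiv ℝ r p (y - p)) 0 := by
    have h1 : HasDerivAt (fun t : ℝ => p + t • (y - p)) (y - p) 0 := by
      simpa using ((hasDerivAt_id (0 : ℝ)).smul_const (y - p)).const_add p
    exact HasFDerivAt.comp_hasDerivAt (0 : ℝ) (by simpa using hr.hasFDerivAt hU hp) h1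
  have hU' : ∀ᶠ t : ℝ in 𝓝[>] 0, p + t • (y - p) ∈ U := by
    have : ContinuousAt (fun t : ℝ => p + t • (y - p)) 0 := by fun_prop
    exact (this.eventually_mem (by simpa using hU.mem_nhds hp)).filter_mono nhdsWithin_le_nhds
  have hlim := hd.tendsto_slope_zero_right
  refine le_of_tendsto hlim ?_
  filter_upwards [hU', Ioo_mem_nhdsGT (zero_lt_one' ℝ)] with t ht ht01
  have hmem : p + t • (y - p) ∈ Ω := by
    have := hc.combo_closure_interior_mem_interior (frontier_subset_closure hpf)
      (hΩ.interior_eq.symm ▸ hy) (a := 1 - t) (b := t) (by linarith [ht01.2]) ht01.1 (by ring)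
    rw [hΩ.interior_eq] at this
    convert this using 1
    module
  have hneg : r (p + t • (y - p)) < 0 := by
    have : p + t • (y - p) ∈ {x ∈ U | r x < 0} := hr.inter_eq ▸ ⟨hmem, ht⟩
    exact this.2
  simp only [zero_add, zero_smul, add_zero, h0, sub_zero, smul_eq_mul]
  exact mul_nonpos_of_nonneg_of_nonpos (inv_nonneg.2 ht01.1.le) hneg.le

theorem eventually_mem (hr : IsC1DefiningFunction Ω U r) (hU : IsOpen U) (hΩ : IsOpen Ω)
    {p : Cn n} (hp : p ∈ U) (hpf : p ∈ frontier Ω) {v : Cn n} (hv : fderiv ℝ r p v < 0) :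
    ∀ᶠ t : ℝ in 𝓝[>] 0, p + t • v ∈ Ω := by
  have h0 := hr.eq_zero hU hΩ hp hpf
  have h1 : HasDerivAt (fun t : ℝ => p + t • v) v 0 := by
    simpa using ((hasDerivAt_id (0 : ℝ)).smul_const v).const_add p
  have hd : HasDerivAt (fun t : ℝ => r (p + t • v)) (fderiv ℝ r p v) 0 :=
    HasFDerivAt.comp_hasDerivAt (0 : ℝ) (by simpa using hr.hasFDerivAt hU hp) h1
  have hU' : ∀ᶠ t : ℝ in 𝓝[>] 0, p + t • v ∈ U :=
    (h1.continuousAt.eventually_mem (by simpa using hU.mem_nhds hp)).filter_mono nhdsWithin_le_nhds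
  filter_upwards [hU', self_mem_nhdsWithin,
    hd.tendsto_slope_zero_right.eventually (gt_mem_nhds hv)] with t ht ht0 hlt
  have ht0 : 0 < t := ht0
  simp only [zero_add, zero_smul, add_zero, h0, sub_zero, smul_eq_mul] at hlt
  have hneg : r (p + t • v) < 0 := by
    by_contra! hge
    exact absurd hlt (not_lt.2 (mul_nonneg (inv_nonneg.2 ht0.le) hge))
  have : p + t • v ∈ Ω ∩ U := by rw [hr.inter_eq]; exact ⟨ht, hneg⟩
  exact this.1

/-- Near a boundary point `p`, a point outside the convex set `Ω` almost lies in the outer half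
space at `p`, up to the oscillation of the normal. -/
theorem exists_neg_le_inner_unitNormal (hr : IsC1DefiningFunction Ω U r) (hU : IsOpen U)
    (hΩ : IsOpen Ω) (hc : Convex ℝ Ω) {p : Cn n} {ρ : ℝ} (hpU : ball p ρ ⊆ U)
    (hpf : p ∈ frontier Ω) {q : Cn n} (hq : q ∉ Ω) (hqp : dist q p < ρ) :
    ∃ p' ∈ frontier Ω ∩ U, dist p' p ≤ dist q p ∧
      -(dist (unitNormal r p) (unitNormal r p') * dist q p) ≤ ⟪unitNormal r p, q - p⟫ := by
  have hpc : p ∈ closure Ω := frontier_subset_closure hpf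
  -- The projection of `q` to the closure. At `p'` the outer normal sees `q` above and `p` below its
  -- tangent plane, so it has nonnegative product with `q - p`; passing to the normal at `p` costs
  -- the oscillation.
  obtain ⟨p', hp'c, hmin⟩ := exists_norm_eq_iInf_of_complete_convex ⟨p, hpc⟩
    isClosed_closure.isComplete hc.closure q
  rw [norm_eq_iInf_iff_real_inner_le_zero hc.closure hp'c] at hmin
  have hdist : dist p' p ≤ dist q p := by
    rw [dist_comm p', dist_eq_norm, dist_eq_norm, ← sq_le_sq₀ (norm_nonneg _) (norm_nonneg _)]
    have h1 := hmin p hpc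
    have h2 := norm_sub_sq_real (q - p') (p - p')
    rw [sub_sub_sub_cancel_right] at h2
    nlinarith [sq_nonneg ‖q - p'‖]
  have hp'f : p' ∈ frontier Ω := by
    rw [hΩ.frontier_eq]
    refine ⟨hp'c, fun hp'Ω => ?_⟩
    have hne : q - p' ≠ 0 := fun h0 => hq (sub_eq_zero.1 h0 ▸ hp'Ω)
    have hcont : ContinuousAt (fun t : ℝ => p' + t • (q - p')) 0 := by fun_prop
    have hev : ∀ᶠ t : ℝ in 𝓝[>] 0, p' + t • (q - p') ∈ Ω :=
      (hcont.eventually_mem (by simpa using hΩ.mem_nhds hp'Ω)).filter_mono nhdsWithin_le_nhds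
    obtain ⟨t, ht, ht0⟩ := (hev.and self_mem_nhdsWithin).exists
    have h1 := hmin _ (subset_closure ht)
    rw [add_sub_cancel_left, inner_smul_right, real_inner_self_eq_norm_sq] at h1
    have h2 : 0 < ‖q - p'‖ := norm_pos_iff.2 hne
    have ht0 : 0 < t := ht0
    have : 0 < t * ‖q - p'‖ ^ 2 := by positivity
    linarith
  have hp'U : p' ∈ U := hpU (mem_ball.2 (hdist.trans_lt hqp))
  refine ⟨p', ⟨hp'f, hp'U⟩, hdist, ?_⟩
  have hne := norm_unitNormal (hr.fderiv_ne_zero p' hp'U)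
  have h1 := hr.fderiv_sub_nonpos hU hΩ hc hp'U hp'f hpc
  -- Moving from `p'` along the inner normal stays in Ω, and by the variational inequality of the
  -- projection such a direction makes a nonpositive product with `q - p'`.
  have h2 : 0 ≤ fderiv ℝ r p' (q - p') := by
    have hv : fderiv ℝ r p' (-realGradient r p') < 0 := by
      rw [map_neg, ← inner_realGradient, real_inner_self_eq_norm_sq]
      have := hne.1
      simp only [Left.neg_neg_iff]
      positivity
    obtain ⟨t, ht, ht0⟩ := ((hr.eventually_mem hU hΩ hp'U hp'f hv).and self_mem_nhdsWithin).exists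
    have ht0 : 0 < t := ht0
    have h3 := hmin _ (subset_closure ht)
    rw [add_sub_cancel_left, inner_smul_right, inner_neg_right, real_inner_comm,
      inner_realGradient] at h3
    by_contra! hneg
    nlinarith
  have h3 : 0 ≤ ⟪unitNormal r p', q - p⟫ := by
    rw [inner_unitNormal]
    refine mul_nonneg (inv_nonneg.2 hne.1.le) ?_
    have : fderiv ℝ r p' (q - p) = fderiv ℝ r p' (q - p') - fderiv ℝ r p' (p - p') := by
      rw [← map_sub]; congr 1; abel
    linarith
  have h4 := abs_real_inner_le_norm (unitNormal r p - unitNormal r p') (q - p)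
  rw [inner_sub_left] at h4
  have h5 := neg_abs_le (⟪unitNormal r p, q - p⟫ - ⟪unitNormal r p', q - p⟫)
  rw [dist_eq_norm, dist_eq_norm]
  linarith

end IsC1DefiningFunction

theorem modulusOfContinuity_mono (N : Cn n → Cn n) (S : Set (Cn n)) :
    Monotone (modulusOfContinuity N S) := by
  intro s t hst
  refine iSup₂_le fun x hx => iSup₂_le fun y hy => iSup_le fun hd => ?_
  exact le_iSup₂_of_le x hx (le_iSup₂_of_le y hy (le_iSup_of_le (hd.trans_le hst) le_rfl))

/-- A monotone function satisfying the Dini condition is summable along `2 ^ (-k)`. -/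
theorem tsum_dyadic_ne_top {W : ℝ → ℝ≥0∞} (hW : Monotone W)
    (hint : ∫⁻ t in Ioc (0 : ℝ) 1, W t / ENNReal.ofReal t < ∞) :
    ∑' k : ℕ, W ((1 / 2) ^ (k + 1)) ≠ ∞ := by
  have hanti : Antitone fun k : ℕ => (1 / 2 : ℝ) ^ k :=
    pow_right_anti₀ (by norm_num) (by norm_num)
  have hdisj : Pairwise (Function.onFun Disjoint fun k : ℕ =>
      Ioc ((1 / 2 : ℝ) ^ (k + 1)) ((1 / 2) ^ k)) := hanti.pairwise_disjoint_on_Ioc_succ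
  have hsub : (⋃ k : ℕ, Ioc ((1 / 2 : ℝ) ^ (k + 1)) ((1 / 2) ^ k)) ⊆ Ioc 0 1 := by
    refine iUnion_subset fun k t ht => ⟨?_, ?_⟩
    · exact (by positivity : (0 : ℝ) < (1 / 2) ^ (k + 1)).trans ht.1
    · exact ht.2.trans (pow_le_one₀ (by norm_num) (by norm_num))
  -- On the k-th dyadic interval, of length 2^(-k-1), the integrand is at least W(2^(-k-1)) /
  -- 2^(-k), which contributes half of W(2^(-k-1)).
  have h1 : ∑' k : ℕ, W ((1 / 2) ^ (k + 1)) * ENNReal.ofReal (1 / 2) ≤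
      ∫⁻ t in Ioc (0 : ℝ) 1, W t / ENNReal.ofReal t := by
    refine le_trans ?_ (lintegral_mono_set hsub)
    rw [lintegral_iUnion (fun _ => measurableSet_Ioc) hdisj]
    refine ENNReal.tsum_le_tsum fun k => ?_
    have hk : (0 : ℝ) < (1 / 2) ^ k := by positivity
    calc W ((1 / 2) ^ (k + 1)) * ENNReal.ofReal (1 / 2)
        = ∫⁻ t in Ioc ((1 / 2 : ℝ) ^ (k + 1)) ((1 / 2) ^ k),
            W ((1 / 2) ^ (k + 1)) / ENNReal.ofReal ((1 / 2) ^ k) := by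
          rw [setLIntegral_const, Real.volume_Ioc, ENNReal.div_eq_inv_mul, mul_comm _ (W _),
            mul_assoc, ← ENNReal.ofReal_inv_of_pos hk, ← ENNReal.ofReal_mul (by positivity)]
          congr 2
          rw [pow_succ]
          field_simp
          norm_num
      _ ≤ _ := by
          refine setLIntegral_mono' measurableSet_Ioc fun t ht => ?_
          exact ENNReal.div_le_div (hW ht.1.le) (ENNReal.ofReal_le_ofReal ht.2)
  rw [ENNReal.tsum_mul_right] at h1
  intro htop
  rw [htop, ENNReal.top_mul (by simp)] at h1
  exact absurd hint (not_lt.2 h1)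

namespace IsMConvexDomain

/-- Uniform Dini estimate for a convex domain with Dini-smooth boundary. -/
theorem exists_dini_normal (h : IsMConvexDomain m Ω) (hs : HasDiniSmoothBoundary Ω) :
    ∃ (ρ : ℝ) (ω : ℕ → ℝ), 0 < ρ ∧ Antitone ω ∧ (∀ k, 0 ≤ ω k) ∧ Summable ω ∧
      ∀ p ∈ frontier Ω, ∃ ν : Cn n, ‖ν‖ = 1 ∧ (∀ y ∈ Ω, 0 ≤ ⟪ν, y - p⟫) ∧
        ∀ k q, dist q p < ρ * (1 / 2) ^ k → dist q p * ω k < ⟪ν, q - p⟫ → q ∈ Ω := by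
  choose! U r hU hpU hr hfin using hs
  have hcompact : IsCompact (frontier Ω) := isCompact_of_isClosed_isBounded isClosed_frontier
    (h.isBounded.closure.subset frontier_subset_closure)
  obtain ⟨s, hsf, hcov⟩ := hcompact.elim_nhds_subcover U
    fun p hp => (hU p hp).mem_nhds (hpU p hp)
  obtain ⟨δ, hδ, hleb⟩ := lebesgue_number_lemma_of_metric (ι := s) (c := fun i => U i.1)
    hcompact (fun i => hU _ (hsf _ i.2)) (by
      intro x hx
      obtain ⟨i, hi, hxi⟩ := mem_iUnion₂.1 (hcov hx)
      exact mem_iUnion.2 ⟨⟨i, hi⟩, hxi⟩)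
  set M : Cn n → ℝ → ℝ≥0∞ := fun i =>
    modulusOfContinuity (unitNormal (r i)) (frontier Ω ∩ U i) with hM
  -- By compactness finitely many charts suffice; the sum of their moduli is a single Dini modulus
  -- valid at every boundary point.
  set W : ℝ → ℝ≥0∞ := fun t => ∑ i ∈ s, M i t with hWdef
  have hMmono : ∀ i, Monotone (M i) := fun i => modulusOfContinuity_mono _ _
  have hW : Monotone W := fun a b hab => Finset.sum_le_sum fun i _ => hMmono i hab
  have hWfin : ∫⁻ t in Ioc (0 : ℝ) 1, W t / ENNReal.ofReal t < ∞ := by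
    have : ∀ t, W t / ENNReal.ofReal t = ∑ i ∈ s, M i t / ENNReal.ofReal t := fun t => by
      simp only [hWdef, ENNReal.div_eq_inv_mul, Finset.mul_sum]
    have hmeas : ∀ i, Measurable fun t => M i t / ENNReal.ofReal t := fun i =>
      (hMmono i).measurable.div ENNReal.measurable_ofReal
    simp_rw [this]
    rw [lintegral_finsetSum _ fun i _ => hmeas i]
    exact ENNReal.sum_lt_top.2 fun i hi => hfin i (hsf i hi)
  have hsum := tsum_dyadic_ne_top hW hWfin
  obtain ⟨K, hK⟩ := exists_pow_lt_of_lt_one hδ (by norm_num : (1 / 2 : ℝ) < 1)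
  have hWk : ∀ k : ℕ, W ((1 / 2) ^ (k + K + 1)) ≠ ∞ := fun k =>
    ENNReal.ne_top_of_tsum_ne_top hsum (k + K)
  -- Since 2^(-K) is below the Lebesgue number, points at distance less than ρ 2^(-k) = 2^(-(k+K+1))
  -- share a chart with `p`, and the oscillation of the normal at that scale is at most
  -- W(2^(-(k+K+1))).
  refine ⟨(1 / 2) ^ (K + 1), fun k => (W ((1 / 2) ^ (k + K + 1))).toReal, by positivity, ?_,
    fun k => ENNReal.toReal_nonneg, ?_, fun p hp => ?_⟩
  · intro a b hab
    refine ENNReal.toReal_mono (hWk a) (hW ?_)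
    exact pow_le_pow_of_le_one (by norm_num) (by norm_num) (by omega)
  · exact (summable_nat_add_iff (f := fun k => (W ((1 / 2) ^ (k + 1))).toReal) K).2
      (ENNReal.summable_toReal hsum)
  obtain ⟨⟨i, his⟩, hball⟩ := hleb p hp
  have hif := hsf i his
  have hri := hr i hif
  have hpi : p ∈ U i := hball (mem_ball_self hδ)
  have hne := norm_unitNormal (hri.fderiv_ne_zero p hpi)
  refine ⟨-unitNormal (r i) p, by rw [norm_neg, hne.2], fun y hy => ?_, fun k q hqp hlt => ?_⟩
  · rw [inner_neg_left, inner_unitNormal]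
    have := hri.fderiv_sub_nonpos (hU i hif) h.isOpen h.convex hpi hp (subset_closure hy)
    have := mul_nonpos_of_nonneg_of_nonpos (inv_nonneg.2 hne.1.le) this
    linarith
  · by_contra hq
    have hqp' : dist q p < (1 / 2) ^ (k + K + 1) := by
      rwa [← pow_add, show K + 1 + k = k + K + 1 by ring] at hqp
    have hqδ : dist q p < δ := hqp'.trans_le
      ((pow_le_pow_of_le_one (by norm_num) (by norm_num) (by omega)).trans hK.le)
    obtain ⟨p', hp', hdist, hle⟩ := hri.exists_neg_le_inner_unitNormal (hU i hif) h.isOpen h.convex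
      hball hp hq hqδ
    have h1 : edist (unitNormal (r i) p) (unitNormal (r i) p') ≤ W ((1 / 2) ^ (k + K + 1)) := by
      refine le_trans ?_ (Finset.single_le_sum (f := fun i => M i ((1 / 2) ^ (k + K + 1)))
        (fun _ _ => zero_le) his)
      refine le_iSup₂_of_le p ⟨hp, hpi⟩ (le_iSup₂_of_le p' hp' (le_iSup_of_le ?_ le_rfl))
      rw [dist_comm]
      exact hdist.trans_lt hqp'
    have h2 : dist (unitNormal (r i) p) (unitNormal (r i) p') ≤
        (W ((1 / 2) ^ (k + K + 1))).toReal := by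
      rw [dist_edist]
      exact ENNReal.toReal_mono (hWk k) h1
    rw [inner_neg_left] at hlt
    nlinarith [dist_nonneg (x := q) (y := p)]

end IsMConvexDomain

end DiniGeometry

/-! ### Kobayashi length of normal segments near a Dini-smooth boundary. -/

section VerticalEstimates

open Set Metric MeasureTheory Filter Topology
open scoped RealInnerProductSpace

variable {n : ℕ} {Ω : Set (Cn n)} {m : ℝ}

theorem real_inner_complex_smul_self (ν : Cn n) (z : ℂ) : ⟪ν, z • ν⟫ = z.re * ‖ν‖ ^ 2 := by
  rw [PiLp.inner_apply, EuclideanSpace.norm_sq_eq, Finset.mul_sum]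
  refine Finset.sum_congr rfl fun i _ => ?_
  rw [Complex.inner, ← Complex.normSq_eq_norm_sq, Complex.normSq_apply]
  simp
  ring

/-- A summable majorant of a summable antitone sequence with controlled quotients. -/
theorem exists_summable_majorant {ω : ℕ → ℝ} (hanti : Antitone ω) (h0 : ∀ k, 0 ≤ ω k)
    (hs : Summable ω) : ∃ e : ℕ → ℝ, (∀ k, 0 < e k) ∧ (∀ k, ω k ≤ e k) ∧
      (∀ k, e k / 2 ≤ e (k + 1)) ∧ (∀ k, e (k + 1) ≤ 3 / 2 * e k) ∧ Summable e := by
  -- A geometrically weighted sum of the earlier terms: halving at each step prevents fast decay,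
  -- monotonicity of `ω` limits growth, and the initial 1 forces positivity.
  let e : ℕ → ℝ := fun k => Nat.rec (1 + ω 0) (fun k a => a / 2 + ω (k + 1)) k
  have e0 : e 0 = 1 + ω 0 := rfl
  have es : ∀ k, e (k + 1) = e k / 2 + ω (k + 1) := fun k => rfl
  have hpos : ∀ k, 0 < e k := by
    intro k
    induction k with
    | zero => rw [e0]; linarith [h0 0]
    | succ k ih => rw [es]; linarith [h0 (k + 1)]
  have hle : ∀ k, ω k ≤ e k := by
    rintro (_ | k)
    · rw [e0]; linarith
    · rw [es]; linarith [hpos k]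
  refine ⟨e, hpos, hle, fun k => by rw [es]; linarith [h0 (k + 1)], fun k => ?_, ?_⟩
  · rw [es]
    have := hanti (Nat.le_succ k)
    have := hle k
    simp only [Nat.succ_eq_add_one] at *
    linarith
  · refine summable_of_sum_range_le (c := 2 * (1 + ∑' k, ω k)) (fun k => (hpos k).le) fun N => ?_
    have key : ∀ N, ∑ k ∈ Finset.range (N + 1), e k + e N ≤
        2 * (1 + ∑ k ∈ Finset.range (N + 1), ω k) := by
      intro N
      induction N with
      | zero => simp [e0]; linarith
      | succ N ih =>
        rw [Finset.sum_range_succ, Finset.sum_range_succ (f := ω), es]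
        linarith
    have h1 : ∑ k ∈ Finset.range N, e k ≤ ∑ k ∈ Finset.range (N + 1), e k + e N := by
      rw [Finset.sum_range_succ]; linarith [hpos N]
    have h2 := hs.sum_le_tsum (Finset.range (N + 1)) fun k _ => h0 k
    linarith [key N]

/-- A round disc in the normal complex line at a Dini-smooth boundary point. -/
theorem disc_mem_of_cone {p ν : Cn n} {R w : ℝ} (hR : 0 < R) (hν : ‖ν‖ = 1) (hw0 : 0 ≤ w)
    (hw1 : w ≤ 1) (hcone : ∀ q, dist q p < 2 * R → dist q p * w < ⟪ν, q - p⟫ → q ∈ Ω) (z : ℂ)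
    (hz : ‖z - (R : ℂ)‖ < R * (1 - w ^ 2)) : p + z • ν ∈ Ω := by
  have hdist : dist (p + z • ν) p = ‖z‖ := by
    rw [dist_eq_norm, add_sub_cancel_left, norm_smul, hν, mul_one]
  have hw2 : w ^ 2 ≤ 1 := by nlinarith
  refine hcone _ ?_ ?_
  · rw [hdist]
    have h1 := norm_add_le (z - (R : ℂ)) (R : ℂ)
    rw [sub_add_cancel, Complex.norm_real, Real.norm_of_nonneg hR.le] at h1
    nlinarith [sq_nonneg w]
  · rw [hdist, add_sub_cancel_left, real_inner_complex_smul_self, hν, one_pow, mul_one]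
    have h1 : ‖z - (R : ℂ)‖ ^ 2 < (R * (1 - w ^ 2)) ^ 2 :=
      pow_lt_pow_left₀ hz (norm_nonneg _) two_ne_zero
    have h2 : ‖z - (R : ℂ)‖ ^ 2 = ‖z‖ ^ 2 - 2 * R * z.re + R ^ 2 := by
      rw [← Complex.normSq_eq_norm_sq, ← Complex.normSq_eq_norm_sq, Complex.normSq_apply,
        Complex.normSq_apply]
      simp; ring
    rw [h2] at h1
    have h3 : R ^ 2 * (w ^ 2 * (1 - w ^ 2)) ≥ 0 := by
      have : 0 ≤ 1 - w ^ 2 := by linarith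
      positivity
    -- The disc inequality gives 2R Re z > |z|² + R²w² + R²w²(1 - w²), and |z|² + R²w² ≥ 2R|z|w.
    have h4 : 2 * R * (‖z‖ * w) < 2 * R * z.re := by
      nlinarith [sq_nonneg (‖z‖ - R * w)]
    exact lt_of_mul_lt_mul_left h4 (by positivity)

/-- The disc of centre R and radius R(1 - w²) starts at height R w² ≤ 4te, which is negligible
against `t`, and its far side is at distance close to 2R because t ≤ Re. Hence its density at `t` is
almost the half-plane density 1 / (2t), with relative error at most 10e. -/
theorem kobayashiMetric_normal_le {p ν : Cn n} {R w e t : ℝ} (hR : 0 < R) (hν : ‖ν‖ = 1)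
    (hw0 : 0 ≤ w) (hwe : w ≤ e) (he : e ≤ 1 / 10)
    (hcone : ∀ q, dist q p < 2 * R → dist q p * w < ⟪ν, q - p⟫ → q ∈ Ω)
    (ht0 : 0 < t) (ht1 : R * e / 4 ≤ t) (ht2 : t ≤ R * e) (a : ℝ) :
    kobayashiMetric Ω (p + t • ν) (a • ν) ≤ ENNReal.ofReal (|a| * ((1 + 10 * e) / (2 * t))) := by
  have he0 : 0 ≤ e := hw0.trans hwe
  have hw2 : w ^ 2 ≤ e ^ 2 := pow_le_pow_left₀ hw0 hwe 2
  have hη : R * w ^ 2 ≤ 4 * t * e := by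
    have : R * w ^ 2 ≤ R * e ^ 2 := by gcongr
    nlinarith
  have hη' : R * w ^ 2 ≤ R * e * (1 / 10) := by
    have : R * w ^ 2 ≤ R * e ^ 2 := by gcongr
    nlinarith [mul_nonneg hR.le he0]
  have h1 : t * (1 - 4 * e) ≤ t - R * w ^ 2 := by nlinarith
  have h2 : 2 * R * (1 - e) ≤ 2 * R - t - R * w ^ 2 := by nlinarith [mul_nonneg hR.le he0]
  have h1p : 0 < t * (1 - 4 * e) := mul_pos ht0 (by linarith)
  have h2p : 0 < 2 * R * (1 - e) := mul_pos (by linarith) (by linarith)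
  have h := kobayashiMetric_le_of_disc (Ω := Ω) (p := p) (w := ν) (c := R) (R := R * (1 - w ^ 2))
    (t := t) (abs_lt.2 ⟨by linarith, by linarith⟩)
    (fun z hz => disc_mem_of_cone hR hν hw0 (by linarith) hcone z hz) a
  rw [Complex.coe_smul] at h
  refine h.trans (ENNReal.ofReal_le_ofReal (mul_le_mul_of_nonneg_left ?_ (abs_nonneg a)))
  have hfac : (R * (1 - w ^ 2)) ^ 2 - (t - R) ^ 2 = (t - R * w ^ 2) * (2 * R - t - R * w ^ 2) := by
    ring
  rw [hfac, div_le_div_iff₀ (mul_pos (by linarith) (by linarith)) (by positivity)]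
  calc R * (1 - w ^ 2) * (2 * t) ≤ R * 1 * (2 * t) := by
        gcongr; linarith [sq_nonneg w]
    _ ≤ (1 + 10 * e) * ((t * (1 - 4 * e)) * (2 * R * (1 - e))) := by
        have : 1 ≤ (1 + 10 * e) * ((1 - 4 * e) * (1 - e)) := by
          nlinarith [mul_nonneg he0 he0, mul_nonneg he0 (mul_nonneg he0 he0)]
        have h5 : 0 ≤ 2 * R * t := by positivity
        nlinarith
    _ ≤ (1 + 10 * e) * ((t - R * w ^ 2) * (2 * R - t - R * w ^ 2)) := by
        have h1q : 0 ≤ t - R * w ^ 2 := h1p.le.trans h1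
        gcongr

theorem kobayashiDist_self {x : Cn n} (hΩ : IsOpen Ω) (hx : x ∈ Ω) : kobayashiDist Ω x x = 0 := by
  obtain ⟨r, hr, hball⟩ := Metric.isOpen_iff.1 hΩ x hx
  refine le_antisymm ((kobayashiDist_le_segment (by simpa using fun _ _ _ => hx)).trans ?_) zero_le
  simp only [sub_self, smul_zero, add_zero]
  rw [setLIntegral_const]
  have := kobayashiMetric_le_of_ball (v := 0) hr hball
  rw [norm_zero, zero_div, ENNReal.ofReal_zero] at this
  rw [le_antisymm this zero_le, zero_mul]

theorem kobayashiDist_normal_segment_le {p ν : Cn n} {s s' κ : ℝ} (hs : 0 < s) (hss : s ≤ s')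
    (hκ : 0 ≤ κ) (hmem : ∀ t ∈ Icc s s', p + t • ν ∈ Ω)
    (hK : ∀ t ∈ Icc s s', ∀ a : ℝ, kobayashiMetric Ω (p + t • ν) (a • ν) ≤
      ENNReal.ofReal (|a| * (κ / (2 * t)))) :
    kobayashiDist Ω (p + s • ν) (p + s' • ν) ≤ ENNReal.ofReal (κ / 2 * Real.log (s' / s)) := by
  set g : ℝ → ℝ := fun τ => s + τ * (s' - s) with hg
  have hgmem : ∀ τ ∈ Icc (0 : ℝ) 1, g τ ∈ Icc s s' := fun τ hτ =>
    ⟨by simp only [hg]; nlinarith [hτ.1], by simp only [hg]; nlinarith [hτ.2]⟩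
  have hgpos : ∀ τ ∈ Icc (0 : ℝ) 1, 0 < g τ := fun τ hτ => hs.trans_le (hgmem τ hτ).1
  have e1 : ∀ τ : ℝ, p + s • ν + τ • (p + s' • ν - (p + s • ν)) = p + g τ • ν := fun τ => by
    simp only [hg]; module
  have e2 : p + s' • ν - (p + s • ν) = (s' - s) • ν := by module
  refine (kobayashiDist_le_segment fun τ hτ => by rw [e1]; exact hmem _ (hgmem τ hτ)).trans ?_
  have hgc : Continuous g := by fun_prop
  have hci : ContinuousOn (fun τ => (s' - s) * (κ / (2 * g τ))) (Icc 0 1) :=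
    continuousOn_const.mul (continuousOn_const.div (by fun_prop) fun τ hτ =>
      (mul_pos two_pos (hgpos τ hτ)).ne')
  calc ∫⁻ τ in Icc (0 : ℝ) 1, kobayashiMetric Ω (p + s • ν + τ • (p + s' • ν - (p + s • ν)))
        (p + s' • ν - (p + s • ν))
      ≤ ∫⁻ τ in Icc (0 : ℝ) 1, ENNReal.ofReal ((s' - s) * (κ / (2 * g τ))) := by
        refine setLIntegral_mono' measurableSet_Icc fun τ hτ => ?_
        rw [e1, e2]
        refine (hK _ (hgmem τ hτ) _).trans_eq ?_
        rw [abs_of_nonneg (sub_nonneg.2 hss)]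
    _ = ENNReal.ofReal (∫ τ in Icc (0 : ℝ) 1, (s' - s) * (κ / (2 * g τ))) := by
        refine (ofReal_integral_eq_lintegral_ofReal (hci.integrableOn_compact isCompact_Icc)
          ((ae_restrict_iff' measurableSet_Icc).2 (Eventually.of_forall fun τ hτ => ?_))).symm
        have := hgpos τ hτ
        have := sub_nonneg.2 hss
        simp only [Pi.zero_apply]
        positivity
    _ = ENNReal.ofReal (κ / 2 * Real.log (s' / s)) := by
        congr 1
        rw [integral_Icc_eq_integral_Ioc, ← intervalIntegral.integral_of_le zero_le_one,
          intervalIntegral.integral_eq_sub_of_hasDerivAt (f := fun τ => κ / 2 * Real.log (g τ))]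
        · have hs' : 0 < s' := hs.trans_le hss
          rw [Real.log_div hs'.ne' hs.ne']
          simp only [hg, one_mul, zero_mul, add_zero, add_sub_cancel]
          ring
        · intro τ hτ
          rw [uIcc_of_le zero_le_one] at hτ
          have hd : HasDerivAt g (s' - s) τ := by
            have := ((hasDerivAt_id τ).mul_const (s' - s)).const_add s
            rwa [one_mul] at this
          refine ((hd.log (hgpos τ hτ).ne').const_mul (κ / 2)).congr_deriv ?_
          ring_nf
        · rw [← uIcc_of_le (zero_le_one' ℝ)] at hci
          exact hci.intervalIntegrable

namespace IsMConvexDomain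

/-- Moving up along the normal costs at most half the logarithm of the ratio of the depths, up to a
bounded error. -/
theorem exists_lift_of_small (h : IsMConvexDomain m Ω) (hs : HasDiniSmoothBoundary Ω) (hn : 0 < n) :
    ∃ τ C : ℝ, 0 < τ ∧ 0 ≤ C ∧ ∀ x ∈ Ω, ∀ s, bdryDist Ω x ≤ s → s ≤ τ → ∃ x' ∈ Ω, ‖x' - x‖ ≤ s ∧
      s / 4 ≤ bdryDist Ω x' ∧
      kobayashiDist Ω x x' ≤ ENNReal.ofReal (1 / 2 * Real.log (s / bdryDist Ω x) + C) := by
  obtain ⟨ρ₀, ω₀, hρ₀, hanti₀, hpos₀, hsum₀, hnormal₀⟩ := h.exists_dini_normal hs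
  obtain ⟨e₀, he₀, hωe₀, hhalf₀, hgrow₀, hesum₀⟩ := exists_summable_majorant hanti₀ hpos₀ hsum₀
  obtain ⟨k₁, hk₁⟩ := (hesum₀.tendsto_atTop_zero.eventually
    (ge_mem_nhds (by norm_num : (0 : ℝ) < 1 / 10))).exists_forall_of_atTop
  -- shift all sequences so that the errors are small
  set e : ℕ → ℝ := fun k => e₀ (k + k₁) with hedef
  set ω : ℕ → ℝ := fun k => ω₀ (k + k₁) with hωdef
  set ρ : ℝ := ρ₀ * (1 / 2) ^ k₁ with hρdef
  have hρ : 0 < ρ := by positivity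
  have he : ∀ k, 0 < e k := fun k => he₀ _
  have he1 : ∀ k, e k ≤ 1 / 10 := fun k => hk₁ _ (by omega)
  have hω0 : ∀ k, 0 ≤ ω k := fun k => hpos₀ _
  have hωe : ∀ k, ω k ≤ e k := fun k => hωe₀ _
  have hesum : Summable e := (summable_nat_add_iff k₁).2 hesum₀
  have hhalf : ∀ k, e k / 2 ≤ e (k + 1) := fun k => by
    have := hhalf₀ (k + k₁)
    rwa [show k + k₁ + 1 = k + 1 + k₁ by ring] at this
  have hgrow : ∀ k, e (k + 1) ≤ 3 / 2 * e k := fun k => by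
    have := hgrow₀ (k + k₁)
    rwa [show k + k₁ + 1 = k + 1 + k₁ by ring] at this
  set R : ℕ → ℝ := fun k => ρ * (1 / 2) ^ (k + 1) with hRdef
  have hR : ∀ k, 0 < R k := fun k => by positivity
  have hRs : ∀ k, R (k + 1) = R k / 2 := fun k => by simp only [hRdef, pow_succ]; ring
  have hR2 : ∀ k, 2 * R k = ρ₀ * (1 / 2) ^ (k + k₁) := fun k => by
    simp only [hRdef, hρdef, pow_succ, pow_add]; ring
  -- The heights at which the disc radius is switched: between `t (k + 1)` and `t k` the disc of
  -- scale `R k` is used. The majorant makes consecutive heights comparable, so each piece has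
  -- logarithmic length at most log 4.
  set t : ℕ → ℝ := fun k => R k * e k with htdef
  have ht : ∀ k, 0 < t k := fun k => mul_pos (hR k) (he k)
  have ht4 : ∀ k, t k / 4 ≤ t (k + 1) := fun k => by
    simp only [htdef, hRs]
    nlinarith [hhalf k, hR k]
  have ht34 : ∀ k, t (k + 1) ≤ 3 / 4 * t k := fun k => by
    simp only [htdef, hRs]
    nlinarith [hgrow k, hR k]
  have htlim : ∀ s, 0 < s → ∃ k, t k ≤ s := by
    intro s hs
    have hle : ∀ k, t k ≤ (3 / 4) ^ k * t 0 := by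
      intro k
      induction k with
      | zero => simp
      | succ k ih => rw [pow_succ]; linarith [ht34 k]
    obtain ⟨k, hk⟩ := exists_pow_lt_of_lt_one (div_pos hs (ht 0)) (by norm_num : (3 / 4 : ℝ) < 1)
    refine ⟨k, (hle k).trans ?_⟩
    rw [lt_div_iff₀ (ht 0)] at hk
    exact hk.le
  have hlog4 : 0 ≤ Real.log 4 := Real.log_nonneg (by norm_num)
  -- The k-th piece exceeds half its logarithmic length by at most ½ · 10 e k · log 4.
  refine ⟨t 0, 5 * Real.log 4 * ∑' k, e k, ht 0,
    mul_nonneg (by positivity) (tsum_nonneg fun k => (he k).le), fun x hx s hxs hst => ?_⟩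
  obtain ⟨p, hp, hxp⟩ := h.exists_nearest hn x
  obtain ⟨ν, hν, hνΩ, hcone₀⟩ := hnormal₀ p hp
  have hδ := h.bdryDist_pos hn hx
  set δ := bdryDist Ω x with hδdef
  have hcone : ∀ k q, dist q p < 2 * R k → dist q p * ω k < ⟪ν, q - p⟫ → q ∈ Ω := fun k q hq =>
    hcone₀ (k + k₁) q (by rwa [← hR2])
  -- the nearest boundary point lies in normal direction
  have hxe : x = p + δ • ν := by
    -- The ball of radius δ about `x` lies in Ω, hence in the half space at `p`. Since |x - p| = δ,
    -- this is the equality case of Cauchy–Schwarz.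
    have h1 : δ ≤ ⟪ν, x - p⟫ := by
      refine le_of_forall_lt fun r hr => ?_
      rcases le_or_gt 0 r with hr0 | hr0
      swap
      · exact hr0.trans_le (hνΩ x hx)
      obtain ⟨r', hrr', hr'⟩ := exists_between hr
      have hmem : x - r' • ν ∈ Ω := h.ball_bdryDist_subset hx (by
        rw [mem_ball, dist_eq_norm, sub_sub_cancel_left, norm_neg, norm_smul, hν, mul_one,
          Real.norm_of_nonneg (by linarith)]
        exact hr')
      have := hνΩ _ hmem
      rw [sub_right_comm, inner_sub_right, inner_smul_right, real_inner_self_eq_norm_sq, hν] at this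
      linarith
    have h2 := norm_sub_sq_real (x - p) (δ • ν)
    rw [inner_smul_right, real_inner_comm, norm_smul, hν, Real.norm_of_nonneg hδ.le, mul_one,
      ← dist_eq_norm x p, ← hxp] at h2
    have h3 : ‖x - p - δ • ν‖ = 0 := by
      have := norm_nonneg (x - p - δ • ν)
      nlinarith
    rw [norm_eq_zero, sub_sub, sub_eq_zero] at h3
    exact h3
  have hlift : ∀ k r, t (k + 1) ≤ r → r ≤ t k → ∀ a : ℝ,
      kobayashiMetric Ω (p + r • ν) (a • ν) ≤
        ENNReal.ofReal (|a| * ((1 + 10 * e k) / (2 * r))) := fun k r hr1 hr2 a =>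
    kobayashiMetric_normal_le (hR k) hν (hω0 k) (hωe k) (he1 k) (hcone k) ((ht _).trans_le hr1)
      ((ht4 k).trans hr1) hr2 a
  have ht0R : t 0 ≤ R 0 / 10 := by
    simp only [htdef]; nlinarith [hR 0, he1 0]
  -- In this ball the normal component exceeds 3r/4, while the cone condition asks only for |q - p|
  -- ω 0 < (5r/4)/10.
  have hballs : ∀ r, 0 < r → r ≤ t 0 → ball (p + r • ν) (r / 4) ⊆ Ω := by
    intro r hr hrt q hq
    rw [mem_ball, dist_eq_norm] at hq
    have hqe : q - p = r • ν + (q - (p + r • ν)) := by abel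
    have h1 : dist q p < 5 / 4 * r := by
      rw [dist_eq_norm, hqe]
      refine (norm_add_le _ _).trans_lt ?_
      rw [norm_smul, hν, Real.norm_of_nonneg hr.le]
      linarith
    refine hcone 0 q (by linarith [hR 0]) ?_
    have h2 : ⟪ν, q - p⟫ = r + ⟪ν, q - (p + r • ν)⟫ := by
      conv_lhs => rw [hqe]
      rw [inner_add_right, inner_smul_right, real_inner_self_eq_norm_sq, hν]; ring
    have h3 := abs_real_inner_le_norm ν (q - (p + r • ν))
    rw [hν, one_mul] at h3
    have h4 := neg_abs_le ⟪ν, q - (p + r • ν)⟫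
    have h5 : ω 0 ≤ 1 / 10 := (hωe 0).trans (he1 0)
    rw [h2]
    nlinarith [dist_nonneg (x := q) (y := p), hω0 0]
  have hmem : ∀ r, 0 < r → r ≤ t 0 → p + r • ν ∈ Ω := fun r hr hrt =>
    hballs r hr hrt (mem_ball_self (by positivity))
  have htanti : ∀ k, t k ≤ t 0 := by
    intro k
    induction k with
    | zero => exact le_rfl
    | succ k ih => linarith [ht34 k, ht k]
  -- Induction on the number of scales, from the top height downwards; each new scale adds its own
  -- error term.
  have chain : ∀ k r r', t k ≤ r → r ≤ r' → r' ≤ t 0 →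
      kobayashiDist Ω (p + r • ν) (p + r' • ν) ≤
        ENNReal.ofReal (1 / 2 * Real.log (r' / r) + 5 * Real.log 4 * ∑ j ∈ Finset.range k, e j) := by
    intro k
    induction k with
    | zero =>
      intro r r' h1 h2 h3
      obtain rfl : r = r' := by linarith
      rw [kobayashiDist_self h.isOpen (hmem r ((ht 0).trans_le h1) h3)]
      exact zero_le
    | succ k ih =>
      have hsum0 : 0 ≤ ∑ j ∈ Finset.range k, e j := Finset.sum_nonneg fun j _ => (he j).le
      have hpiece : ∀ r r', t (k + 1) ≤ r → r ≤ r' → r' ≤ t k →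
          kobayashiDist Ω (p + r • ν) (p + r' • ν) ≤
            ENNReal.ofReal (1 / 2 * Real.log (r' / r) + 5 * Real.log 4 * e k) := by
        intro r r' h1 h2 h3
        have hr : 0 < r := (ht _).trans_le h1
        refine (kobayashiDist_normal_segment_le (κ := 1 + 10 * e k) hr h2 (by linarith [he k])
          (fun q hq => hmem q (hr.trans_le hq.1) (hq.2.trans (h3.trans (htanti k))))
          (fun q hq => hlift k q (h1.trans hq.1) (hq.2.trans h3))).trans
          (ENNReal.ofReal_le_ofReal ?_)
        have h4 : Real.log (r' / r) ≤ Real.log 4 := by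
          refine Real.log_le_log (div_pos (hr.trans_le h2) hr) ?_
          rw [div_le_iff₀ hr]
          linarith [ht4 k]
        nlinarith [he k]
      intro r r' h1 h2 h3
      have hr : 0 < r := (ht _).trans_le h1
      have hr' : 0 < r' := hr.trans_le h2
      have hnn : ∀ a b : ℝ, 0 < a → a ≤ b → 0 ≤ Real.log (b / a) := fun a b ha hab =>
        Real.log_nonneg ((one_le_div ha).2 hab)
      rw [Finset.sum_range_succ]
      rcases le_total (t k) r with h4 | h4
      · refine (ih r r' h4 h2 h3).trans (ENNReal.ofReal_le_ofReal ?_)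
        nlinarith [mul_nonneg hlog4 (he k).le]
      rcases le_total r' (t k) with h5 | h5
      · refine (hpiece r r' h1 h2 h5).trans (ENNReal.ofReal_le_ofReal ?_)
        nlinarith [mul_nonneg hlog4 hsum0]
      · refine (kobayashiDist_triangle _ (p + t k • ν) _).trans ((add_le_add (hpiece r (t k) h1 h4 le_rfl)
          (ih (t k) r' le_rfl h5 h3)).trans ?_)
        have i1 := hnn r (t k) hr h4
        have i2 := hnn (t k) r' (ht k) h5
        have i3 := mul_nonneg hlog4 (he k).le
        have i4 := mul_nonneg hlog4 hsum0
        rw [← ENNReal.ofReal_add (by linarith) (by linarith)]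
        refine ENNReal.ofReal_le_ofReal (le_of_eq ?_)
        rw [Real.log_div (ht k).ne' hr.ne', Real.log_div hr'.ne' (ht k).ne',
          Real.log_div hr'.ne' hr.ne']
        ring
  have hs0 : 0 < s := hδ.trans_le hxs
  refine ⟨p + s • ν, hmem s hs0 hst, ?_, ?_, ?_⟩
  · rw [hxe, add_sub_add_left_eq_sub, ← sub_smul, norm_smul, hν, mul_one,
      Real.norm_of_nonneg (by linarith)]
    linarith
  · refine (le_infDist (h.frontier_nonempty hn)).2 fun q hq => ?_
    by_contra! hlt
    refine h.notMem_of_mem_frontier hq (hballs s hs0 hst ?_)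
    rwa [mem_ball, dist_comm]
  · obtain ⟨k, hk⟩ := htlim δ hδ
    conv_lhs => rw [hxe]
    refine (chain k δ s hk hxs hst).trans (ENNReal.ofReal_le_ofReal ?_)
    have := hesum.sum_le_tsum (Finset.range k) fun j _ => (he j).le
    gcongr

end IsMConvexDomain

end VerticalEstimates

/-! ### Upper bound for the distance and comparison of isometric configurations. -/

section DistanceEstimates

open Set Metric MeasureTheory Filter Topology

variable {n : ℕ} {Ω : Set (Cn n)} {m : ℝ}

/-- By convexity the ball of radius `r` can be carried along the whole segment inside Ω. -/
theorem kobayashiDist_le_of_balls (hc : Convex ℝ Ω) {x y : Cn n} {r : ℝ} (hr : 0 < r)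
    (hx : ball x r ⊆ Ω) (hy : ball y r ⊆ Ω) :
    kobayashiDist Ω x y ≤ ENNReal.ofReal (‖y - x‖ / r) := by
  have hball : ∀ t ∈ Icc (0 : ℝ) 1, ball (x + t • (y - x)) r ⊆ Ω := by
    intro t ht z hz
    set v := z - (x + t • (y - x)) with hv
    have hvr : ‖v‖ < r := by rwa [mem_ball, dist_eq_norm] at hz
    have h1 : x + v ∈ Ω := hx (by rwa [mem_ball, dist_eq_norm, add_sub_cancel_left])
    have h2 : y + v ∈ Ω := hy (by rwa [mem_ball, dist_eq_norm, add_sub_cancel_left])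
    have h3 := hc h1 h2 (sub_nonneg.2 ht.2) ht.1 (by ring)
    convert h3 using 1
    rw [hv]; module
  refine (kobayashiDist_le_segment fun t ht => hball t ht (mem_ball_self hr)).trans ?_
  calc _ ≤ ∫⁻ _ in Icc (0 : ℝ) 1, ENNReal.ofReal (‖y - x‖ / r) :=
        setLIntegral_mono' measurableSet_Icc fun t ht => kobayashiMetric_le_of_ball hr (hball t ht)
    _ = _ := by rw [setLIntegral_const]; simp

namespace IsMConvexDomain

/-- Extends `exists_lift_of_small` from heights up to τ to heights up to `S`, at the price of the
constant `c`: beyond τ the lift stops at τ, and a point already deeper than τ is left in place. -/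
theorem exists_lift (h : IsMConvexDomain m Ω) (hs : HasDiniSmoothBoundary Ω) (hn : 0 < n) {S : ℝ}
    (hS : 0 < S) : ∃ c C : ℝ, 0 < c ∧ 0 ≤ C ∧ ∀ x ∈ Ω, ∀ s, bdryDist Ω x ≤ s → s ≤ S →
      ∃ x' ∈ Ω, ‖x' - x‖ ≤ s ∧ c * s ≤ bdryDist Ω x' ∧
      kobayashiDist Ω x x' ≤ ENNReal.ofReal (1 / 2 * Real.log (s / bdryDist Ω x) + C) := by
  obtain ⟨τ, C, hτ, hC, hlift⟩ := h.exists_lift_of_small hs hn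
  refine ⟨min (1 / 4) (τ / (4 * S)), C, by positivity, hC, fun x hx s hxs hsS => ?_⟩
  have hδ := h.bdryDist_pos hn hx
  have hs0 : 0 < s := hδ.trans_le hxs
  have hτS : τ / (4 * S) * s ≤ τ / 4 := by
    rw [div_mul_eq_mul_div, div_le_div_iff₀ (by positivity) (by norm_num)]
    nlinarith
  rcases le_total s τ with hsτ | hsτ
  · obtain ⟨x', hx', h1, h2, h3⟩ := hlift x hx s hxs hsτ
    refine ⟨x', hx', h1, le_trans ?_ h2, h3⟩
    have := min_le_left (1 / 4 : ℝ) (τ / (4 * S))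
    nlinarith
  have hcs : min (1 / 4) (τ / (4 * S)) * s ≤ τ / 4 :=
    (mul_le_mul_of_nonneg_right (min_le_right _ _) hs0.le).trans hτS
  rcases le_total (bdryDist Ω x) τ with hxτ | hxτ
  · obtain ⟨x', hx', h1, h2, h3⟩ := hlift x hx τ hxτ le_rfl
    refine ⟨x', hx', h1.trans hsτ, hcs.trans h2, h3.trans (ENNReal.ofReal_le_ofReal ?_)⟩
    have := Real.log_le_log (div_pos hτ hδ) (div_le_div_of_nonneg_right hsτ hδ.le)
    linarith
  · refine ⟨x, hx, by simpa using hs0.le, by linarith, ?_⟩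
    rw [kobayashiDist_self h.isOpen hx]
    exact zero_le

/-- Upper bound for the Kobayashi distance of two points in terms of their depths and their
Euclidean distance. -/
theorem exists_kobayashiDist_le (h : IsMConvexDomain m Ω) (hs : HasDiniSmoothBoundary Ω)
    (hn : 0 < n) : ∃ C : ℝ, ∀ x ∈ Ω, ∀ y ∈ Ω, ∀ a : ℝ, ENNReal.ofReal a ≤ kobayashiDist Ω x y →
      a ≤ Real.log (‖x - y‖ + bdryDist Ω x + bdryDist Ω y) - 1 / 2 * Real.log (bdryDist Ω x) -
        1 / 2 * Real.log (bdryDist Ω y) + C := by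
  obtain ⟨D, hD, hDle⟩ := h.exists_bdryDist_le hn
  obtain ⟨R, hR, hRle⟩ := h.isBounded.exists_pos_norm_le
  obtain ⟨c, C, hc, hC, hlift⟩ := h.exists_lift hs hn (S := 2 * R + 2 * D) (by positivity)
  refine ⟨2 * C + 3 / c, fun x hx y hy a ha => ?_⟩
  have hδx := h.bdryDist_pos hn hx
  have hδy := h.bdryDist_pos hn hy
  -- The common height to which both points are raised. The raised points are at most 3s apart and
  -- centres of balls of radius cs in Ω, so joining them costs at most 3 / c.
  set s := ‖x - y‖ + bdryDist Ω x + bdryDist Ω y with hsdef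
  have hxy := norm_nonneg (x - y)
  have hs0 : 0 < s := by positivity
  have hsS : s ≤ 2 * R + 2 * D := by
    have := norm_sub_le x y
    linarith [hRle x hx, hRle y hy, hDle x hx, hDle y hy]
  obtain ⟨x', hx', hx1, hx2, hx3⟩ := hlift x hx s (by linarith) hsS
  obtain ⟨y', hy', hy1, hy2, hy3⟩ := hlift y hy s (by linarith) hsS
  have hcs : 0 < c * s := by positivity
  have hmid : kobayashiDist Ω x' y' ≤ ENNReal.ofReal (3 / c) := by
    refine (kobayashiDist_le_of_balls h.convex hcs
      ((ball_subset_ball hx2).trans (h.ball_bdryDist_subset hx'))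
      ((ball_subset_ball hy2).trans (h.ball_bdryDist_subset hy'))).trans
      (ENNReal.ofReal_le_ofReal ?_)
    rw [div_le_div_iff₀ hcs hc]
    have h1 : ‖y' - x'‖ ≤ 3 * s := by
      have e : y' - x' = (y' - y) - (x - y) - (x' - x) := by abel
      rw [e]
      have h2 := norm_sub_le ((y' - y) - (x - y)) (x' - x)
      have h3 := norm_sub_le (y' - y) (x - y)
      linarith
    nlinarith
  have hlog : ∀ δ, 0 < δ → δ ≤ s → 0 ≤ Real.log (s / δ) := fun δ h0 h1 =>
    Real.log_nonneg ((one_le_div h0).2 h1)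
  have i1 := hlog _ hδx (by linarith)
  have i2 := hlog _ hδy (by linarith)
  have i3 : 0 < 3 / c := by positivity
  have htot : kobayashiDist Ω x y ≤ ENNReal.ofReal ((1 / 2 * Real.log (s / bdryDist Ω x) + C) +
      (3 / c + (1 / 2 * Real.log (s / bdryDist Ω y) + C))) := by
    rw [ENNReal.ofReal_add (p := 1 / 2 * Real.log (s / bdryDist Ω x) + C) (by linarith)
      (by linarith), ENNReal.ofReal_add (p := 3 / c) (by linarith) (by linarith)]
    refine (kobayashiDist_triangle x x' y).trans (add_le_add hx3 ?_)
    refine (kobayashiDist_triangle x' y' y).trans (add_le_add hmid ?_)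
    rwa [kobayashiDist_comm]
  -- The bound is nonnegative, so truncation by `ENNReal.ofReal` is harmless and `a`, which may be
  -- negative, satisfies a genuine real inequality.
  have hfin := (ENNReal.ofReal_le_ofReal_iff (by linarith)).1 (ha.trans htot)
  rw [Real.log_div hs0.ne' hδx.ne', Real.log_div hs0.ne' hδy.ne'] at hfin
  linarith

end IsMConvexDomain

variable {ι : Type*} {Ω' : Set (Cn n)} {a b : ι → Cn n}

/-- Configurations with equal Kobayashi distances have comparable depths. -/
theorem exists_bdryDist_le_mul_bdryDist [Nonempty ι] (hn : 0 < n) (h : IsMConvexDomain m Ω)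
    (hs : HasDiniSmoothBoundary Ω) (h' : IsMConvexDomain m Ω') (ha : ∀ i, a i ∈ Ω)
    (hb : ∀ i, b i ∈ Ω')
    (hab : ∀ i j, kobayashiDist Ω (a i) (a j) = kobayashiDist Ω' (b i) (b j)) :
    ∃ C : ℝ, 0 < C ∧ ∀ i, bdryDist Ω (a i) ≤ C * bdryDist Ω' (b i) := by
  -- A base index. From `b i` to `b o` the distance is at least -½ log of the depth of `b i`, and
  -- from `a i` to `a o` at most -½ log of the depth of `a i`, up to constants. Indexed families
  -- keep the two sides interchangeable, with no inverse map needed.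
  obtain ⟨o⟩ := ‹Nonempty ι›
  obtain ⟨C, hC⟩ := h.exists_kobayashiDist_le hs hn
  obtain ⟨D, hD, hDle⟩ := h.exists_bdryDist_le hn
  obtain ⟨R, hR, hRle⟩ := h.isBounded.exists_pos_norm_le
  refine ⟨Real.exp (2 * Real.log (2 * R + 2 * D) - Real.log (bdryDist Ω (a o)) + 2 * C -
    Real.log (bdryDist Ω' (b o))), Real.exp_pos _, fun i => ?_⟩
  have hδ := h.bdryDist_pos hn (ha i)
  have hδo := h.bdryDist_pos hn (ha o)
  have hδ' := h'.bdryDist_pos hn (hb i)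
  have h1 := h'.half_log_bdryDist_sub_le hn (hb i) (hb o)
  rw [← hab] at h1
  have h2 := hC _ (ha i) _ (ha o) _ h1
  have h3 : Real.log (‖a i - a o‖ + bdryDist Ω (a i) + bdryDist Ω (a o)) ≤
      Real.log (2 * R + 2 * D) := by
    refine Real.log_le_log (by positivity) ?_
    have := norm_sub_le (a i) (a o)
    linarith [hRle _ (ha i), hRle _ (ha o), hDle _ (ha i), hDle _ (ha o)]
  rw [← Real.log_le_log_iff hδ (by positivity), Real.log_mul (Real.exp_pos _).ne' hδ'.ne',
    Real.log_exp]
  linarith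

/-- Hölder-type estimate for configurations with equal Kobayashi distances. -/
theorem exists_norm_sub_rpow_le [Nonempty ι] (hn : 0 < n) (h : IsMConvexDomain m Ω)
    (hs : HasDiniSmoothBoundary Ω) (h' : IsMConvexDomain m Ω') (hs' : HasDiniSmoothBoundary Ω')
    (ha : ∀ i, a i ∈ Ω) (hb : ∀ i, b i ∈ Ω')
    (hab : ∀ i j, kobayashiDist Ω (a i) (a j) = kobayashiDist Ω' (b i) (b j)) :
    ∃ C : ℝ, 0 < C ∧ ∀ i j, ‖b i - b j‖ ^ m ≤
      C * (‖a i - a j‖ + bdryDist Ω (a i) + bdryDist Ω (a j)) := by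
  have hm : 0 < m := by linarith [h.one_lt]
  -- Applied with the two sides exchanged: the depth of `b k` must be at most a multiple of that of
  -- `a k` for the half logarithms to cancel.
  obtain ⟨E, hE, hδE⟩ := exists_bdryDist_le_mul_bdryDist hn h' hs' h hb ha fun i j => (hab i j).symm
  obtain ⟨C, hC⟩ := h.exists_kobayashiDist_le hs hn
  obtain ⟨C', hC'⟩ := h'.exists_le_kobayashiDist hn
  refine ⟨Real.exp (C + C' + Real.log E), Real.exp_pos _, fun i j => ?_⟩
  have hδi := h.bdryDist_pos hn (ha i)
  have hδj := h.bdryDist_pos hn (ha j)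
  have hδi' := h'.bdryDist_pos hn (hb i)
  have hδj' := h'.bdryDist_pos hn (hb j)
  by_cases hbij : b i = b j
  · rw [hbij, sub_self, norm_zero, Real.zero_rpow hm.ne']
    positivity
  have hpos : 0 < ‖b i - b j‖ := norm_pos_iff.2 (sub_ne_zero.2 hbij)
  have h1 := hC' _ (hb i) _ (hb j) hbij
  rw [← hab] at h1
  have h2 := hC _ (ha i) _ (ha j) _ h1
  have h3 : ∀ k, Real.log (bdryDist Ω' (b k)) ≤ Real.log E + Real.log (bdryDist Ω (a k)) := by
    intro k
    rw [← Real.log_mul hE.ne' (h.bdryDist_pos hn (ha k)).ne']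
    exact Real.log_le_log (h'.bdryDist_pos hn (hb k)) (hδE k)
  have hs0 : 0 < ‖a i - a j‖ + bdryDist Ω (a i) + bdryDist Ω (a j) := by positivity
  rw [← Real.log_le_log_iff (Real.rpow_pos_of_pos hpos _) (by positivity), Real.log_rpow hpos,
    Real.log_mul (Real.exp_pos _).ne' hs0.ne', Real.log_exp]
  linarith [h3 i, h3 j]

end DistanceEstimates

/-! ### Extension of the isometry to the closures and the bi-Hölder bound. -/

section BoundaryExtension

open Set Metric MeasureTheory Filter Topology

variable {n : ℕ} {m : ℝ} {Ω₁ Ω₂ : Set (Cn n)} {g : Cn n → Cn n}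

/-- A map preserving the Kobayashi distances is continuous for the Euclidean topologies. -/
theorem continuousOn_of_kobayashiDist_eq (hn : 0 < n) (h₁ : IsMConvexDomain m Ω₁)
    (h₂ : IsMConvexDomain m Ω₂) (hg : MapsTo g Ω₁ Ω₂)
    (hiso : ∀ x ∈ Ω₁, ∀ y ∈ Ω₁, kobayashiDist Ω₁ x y = kobayashiDist Ω₂ (g x) (g y)) :
    ContinuousOn g Ω₁ := by
  obtain ⟨c, hc, hle⟩ := h₂.exists_norm_sub_le_kobayashiDist hn
  intro x hx
  set r := bdryDist Ω₁ x with hr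
  have hr0 : 0 < r := h₁.bdryDist_pos hn hx
  -- Locally the Kobayashi distance of the source is at most a multiple of the Euclidean one, and in
  -- the target it is at least such a multiple, so the map is Lipschitz at `x`.
  have hbound : ∀ y ∈ ball x (r / 2), dist (g y) (g x) ≤ 2 / (c * r) * dist y x := by
    intro y hy
    have hballx : ball x (r / 2) ⊆ Ω₁ :=
      (ball_subset_ball (by linarith)).trans (h₁.ball_bdryDist_subset hx)
    have hbally : ball y (r / 2) ⊆ Ω₁ := by
      refine (ball_subset_ball' ?_).trans (h₁.ball_bdryDist_subset hx)
      rw [mem_ball] at hy; linarith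
    have hyΩ := hballx hy
    have h3 := (hle _ (hg hx) _ (hg hyΩ)).trans ((hiso x hx y hyΩ).symm.trans_le
      (kobayashiDist_le_of_balls h₁.convex (half_pos hr0) hballx hbally))
    rw [ENNReal.ofReal_le_ofReal_iff (by positivity), norm_sub_rev, ← dist_eq_norm,
      ← dist_eq_norm] at h3
    rw [div_mul_eq_mul_div, le_div_iff₀ (by positivity)]
    rw [le_div_iff₀ (by positivity)] at h3
    linarith
  refine ContinuousAt.continuousWithinAt ?_
  rw [ContinuousAt, tendsto_iff_dist_tendsto_zero]
  refine squeeze_zero' (Eventually.of_forall fun _ => dist_nonneg)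
    (eventually_of_mem (ball_mem_nhds x (half_pos hr0)) hbound) ?_
  have : Tendsto (fun y => dist y x) (𝓝 x) (𝓝 0) := tendsto_iff_dist_tendsto_zero.1 tendsto_id
  simpa using this.const_mul (2 / (c * r))

theorem injOn_of_kobayashiDist_eq (hn : 0 < n) (h₁ : IsMConvexDomain m Ω₁)
    (h₂ : IsMConvexDomain m Ω₂) (hg : MapsTo g Ω₁ Ω₂)
    (hiso : ∀ x ∈ Ω₁, ∀ y ∈ Ω₁, kobayashiDist Ω₁ x y = kobayashiDist Ω₂ (g x) (g y)) :
    InjOn g Ω₁ := by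
  obtain ⟨c, hc, hle⟩ := h₁.exists_norm_sub_le_kobayashiDist hn
  intro x hx y hy hxy
  have h1 := hle x hx y hy
  rw [hiso x hx y hy, hxy, kobayashiDist_self h₂.isOpen (hg hy), nonpos_iff_eq_zero,
    ENNReal.ofReal_eq_zero] at h1
  have h2 : ‖x - y‖ ≤ 0 := by
    by_contra! h3
    exact absurd h1 (not_le.2 (mul_pos hc h3))
  exact sub_eq_zero.1 (norm_le_zero_iff.1 h2)

theorem mem_frontier_iff_bdryDist_eq_zero {Ω : Set (Cn n)} (hne : (frontier Ω).Nonempty)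
    {x : Cn n} : x ∈ frontier Ω ↔ bdryDist Ω x = 0 :=
  isClosed_frontier.mem_iff_infDist_zero hne

/-- A map satisfying a Hölder estimate with boundary-distance error terms has limits at the
boundary. -/
theorem exists_tendsto_of_norm_sub_rpow_le {Ω : Set (Cn n)} {C : ℝ} (hm : 0 < m) (hC : 0 < C)
    (hle : ∀ x ∈ Ω, ∀ y ∈ Ω, ‖g x - g y‖ ^ m ≤ C * (‖x - y‖ + bdryDist Ω x + bdryDist Ω y))
    {a : Cn n} (ha : a ∈ closure Ω) (haf : a ∈ frontier Ω) :
    ∃ y, Tendsto g (𝓝[Ω] a) (𝓝 y) := by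
  have : NeBot (𝓝[Ω] a) := mem_closure_iff_nhdsWithin_neBot.1 ha
  refine cauchy_map_iff_exists_tendsto.1 (Metric.cauchy_iff.2 ⟨inferInstance, fun ε hε => ?_⟩)
  -- Points within η of `a` are less than 2η apart and have depth less than η, so the bracket is
  -- below 4η; the 5 leaves room.
  set η := ε ^ m / (5 * C) with hη
  have hη0 : 0 < η := by positivity
  refine ⟨g '' (Ω ∩ ball a η), image_mem_map ?_, ?_⟩
  · exact inter_mem self_mem_nhdsWithin (mem_nhdsWithin_of_mem_nhds (ball_mem_nhds a hη0))
  · rintro _ ⟨x, ⟨hx, hxa⟩, rfl⟩ _ ⟨y, ⟨hy, hya⟩, rfl⟩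
    have h1 : bdryDist Ω x < η := (infDist_le_dist_of_mem haf).trans_lt hxa
    have h2 : bdryDist Ω y < η := (infDist_le_dist_of_mem haf).trans_lt hya
    have h3 : ‖x - y‖ < 2 * η := by
      rw [← dist_eq_norm]
      have := dist_triangle_right x y a
      rw [mem_ball] at hxa hya
      linarith
    have h4 : ‖g x - g y‖ ^ m < ε ^ m := by
      refine (hle x hx y hy).trans_lt ?_
      calc C * (‖x - y‖ + bdryDist Ω x + bdryDist Ω y) < C * (5 * η) := by gcongr; linarith
        _ = ε ^ m := by rw [hη]; field_simp
    rw [dist_eq_norm]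
    exact (Real.rpow_lt_rpow_iff (norm_nonneg _) hε.le hm).1 h4

theorem theorem1p5 (n : ℕ) (hn : 2 ≤ n) (m : ℝ) (Ω₁ Ω₂ : Set (Cn n))
    (h₁ : IsMConvexDomain m Ω₁) (h₂ : IsMConvexDomain m Ω₂)
    (hs₁ : HasDiniSmoothBoundary Ω₁) (hs₂ : HasDiniSmoothBoundary Ω₂)
    (f : Ω₁ → Ω₂) (hf : IsKobayashiIsometry f) :
    ∃ (F : closure Ω₁ ≃ₜ closure Ω₂) (g : frontier Ω₁ → frontier Ω₂),
      (∀ x : Ω₁, (F ⟨x, subset_closure x.2⟩ : Cn n) = f x) ∧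
      (∀ p : frontier Ω₁, (F ⟨p, frontier_subset_closure p.2⟩ : Cn n) = g p) ∧
      IsBiHolder (1 / m) g := by
  have hn0 : 0 < n := by omega
  have hm : 0 < m := by linarith [h₁.one_lt]
  have hfr₁ := h₁.frontier_nonempty hn0
  have hfr₂ := h₂.frontier_nonempty hn0
  have hnonempty : Nonempty Ω₁ := h₁.nonempty.to_subtype
  set g : Cn n → Cn n := Function.extend Subtype.val (fun x => (f x : Cn n)) 0 with hgdef
  have hgf : ∀ x : Ω₁, g x = f x := fun x => Subtype.val_injective.extend_apply _ _ _
  have hg : MapsTo g Ω₁ Ω₂ := fun x hx => by rw [hgf ⟨x, hx⟩]; exact (f _).2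
  have hiso : ∀ x ∈ Ω₁, ∀ y ∈ Ω₁, kobayashiDist Ω₁ x y = kobayashiDist Ω₂ (g x) (g y) := by
    intro x hx y hy
    rw [hgf ⟨x, hx⟩, hgf ⟨y, hy⟩]
    exact (hf ⟨x, hx⟩ ⟨y, hy⟩).symm
  have hgc := continuousOn_of_kobayashiDist_eq hn0 h₁ h₂ hg hiso
  have hginj := injOn_of_kobayashiDist_eq hn0 h₁ h₂ hg hiso
  -- the quantitative estimates inside the domains
  have hmem₁ : ∀ i : Ω₁, (i : Cn n) ∈ Ω₁ := fun i => i.2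
  have hmem₂ : ∀ i : Ω₁, g i ∈ Ω₂ := fun i => hg i.2
  have hiso' : ∀ i j : Ω₁, kobayashiDist Ω₁ (i : Cn n) j = kobayashiDist Ω₂ (g i) (g j) :=
    fun i j => hiso i i.2 j j.2
  obtain ⟨D₁, hD₁, hδ₁⟩ := exists_bdryDist_le_mul_bdryDist hn0 h₁ hs₁ h₂ hmem₁ hmem₂ hiso'
  obtain ⟨D₂, hD₂, hδ₂⟩ := exists_bdryDist_le_mul_bdryDist hn0 h₂ hs₂ h₁ hmem₂ hmem₁
    fun i j => (hiso' i j).symm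
  obtain ⟨C₁, hC₁, hle₁⟩ := exists_norm_sub_rpow_le hn0 h₁ hs₁ h₂ hs₂ hmem₁ hmem₂ hiso'
  obtain ⟨C₂, hC₂, hle₂⟩ := exists_norm_sub_rpow_le hn0 h₂ hs₂ h₁ hs₁ hmem₂ hmem₁
    fun i j => (hiso' i j).symm
  -- the continuous extension to the closure
  have hlim : ∀ a ∈ closure Ω₁, ∃ y, Tendsto g (𝓝[Ω₁] a) (𝓝 y) := by
    intro a ha
    by_cases haΩ : a ∈ Ω₁
    · exact ⟨g a, hgc a haΩ⟩
    · exact exists_tendsto_of_norm_sub_rpow_le hm hC₁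
        (fun x hx y hy => hle₁ ⟨x, hx⟩ ⟨y, hy⟩) ha (by
          rw [h₁.isOpen.frontier_eq]; exact ⟨ha, haΩ⟩)
  set G : Cn n → Cn n := extendFrom Ω₁ g with hG
  have hGlim : ∀ a ∈ closure Ω₁, Tendsto g (𝓝[Ω₁] a) (𝓝 (G a)) := fun a ha =>
    tendsto_extendFrom (hlim a ha)
  have hGc : ContinuousOn G (closure Ω₁) := continuousOn_extendFrom subset_rfl hlim
  have hGg : ∀ x ∈ Ω₁, G x = g x := fun x hx => extendFrom_eq (subset_closure hx) (hgc x hx)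
  have hGmaps : MapsTo G (closure Ω₁) (closure Ω₂) := by
    intro a ha
    have : NeBot (𝓝[Ω₁] a) := mem_closure_iff_nhdsWithin_neBot.1 ha
    exact mem_closure_of_tendsto (hGlim a ha) (eventually_of_mem self_mem_nhdsWithin hg)
  -- the estimates pass to the boundary
  have hδc : ∀ Ω : Set (Cn n), Continuous (bdryDist Ω) := fun Ω => continuous_infDist_pt _
  have hself : ∀ a, Tendsto (fun x : Cn n => x) (𝓝[Ω₁] a) (𝓝 a) := fun a =>
    tendsto_id.mono_left nhdsWithin_le_nhds
  have hdepth : ∀ a ∈ closure Ω₁, bdryDist Ω₁ a ≤ D₁ * bdryDist Ω₂ (G a) ∧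
      bdryDist Ω₂ (G a) ≤ D₂ * bdryDist Ω₁ a := by
    intro a ha
    have : NeBot (𝓝[Ω₁] a) := mem_closure_iff_nhdsWithin_neBot.1 ha
    have t1 := ((hδc Ω₁).tendsto a).comp (hself a)
    have t2 := ((hδc Ω₂).tendsto (G a)).comp (hGlim a ha)
    exact ⟨le_of_tendsto_of_tendsto t1 (t2.const_mul D₁)
      (eventually_of_mem self_mem_nhdsWithin fun x hx => hδ₁ ⟨x, hx⟩),
      le_of_tendsto_of_tendsto t2 (t1.const_mul D₂)
      (eventually_of_mem self_mem_nhdsWithin fun x hx => hδ₂ ⟨x, hx⟩)⟩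
  -- Comparable depths vanish together, so boundary points go to boundary points and interior points
  -- to interior points.
  have hfrontier : ∀ a ∈ closure Ω₁, (a ∈ frontier Ω₁ ↔ G a ∈ frontier Ω₂) := by
    intro a ha
    rw [mem_frontier_iff_bdryDist_eq_zero hfr₁, mem_frontier_iff_bdryDist_eq_zero hfr₂]
    obtain ⟨i1, i2⟩ := hdepth a ha
    have p1 : 0 ≤ bdryDist Ω₁ a := infDist_nonneg
    have p2 : 0 ≤ bdryDist Ω₂ (G a) := infDist_nonneg
    constructor
    · intro h; rw [h, mul_zero] at i2; exact le_antisymm i2 p2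
    · intro h; rw [h, mul_zero] at i1; exact le_antisymm i1 p1
  -- In the limit the depth terms vanish and pure Hölder inequalities remain in both directions.
  have hbdry : ∀ a ∈ frontier Ω₁, ∀ b ∈ frontier Ω₁,
      ‖G a - G b‖ ^ m ≤ C₁ * ‖a - b‖ ∧ ‖a - b‖ ^ m ≤ C₂ * ‖G a - G b‖ := by
    intro a ha b hb
    have hac := frontier_subset_closure ha
    have hbc := frontier_subset_closure hb
    have : NeBot (𝓝[Ω₁] a) := mem_closure_iff_nhdsWithin_neBot.1 hac
    have : NeBot (𝓝[Ω₁] b) := mem_closure_iff_nhdsWithin_neBot.1 hbc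
    have a1 : Tendsto (fun p : Cn n × Cn n => p.1) (𝓝[Ω₁] a ×ˢ 𝓝[Ω₁] b) (𝓝 a) :=
      (hself a).comp tendsto_fst
    have b1 : Tendsto (fun p : Cn n × Cn n => p.2) (𝓝[Ω₁] a ×ˢ 𝓝[Ω₁] b) (𝓝 b) :=
      (hself b).comp tendsto_snd
    have a2 : Tendsto (fun p : Cn n × Cn n => g p.1) (𝓝[Ω₁] a ×ˢ 𝓝[Ω₁] b) (𝓝 (G a)) :=
      (hGlim a hac).comp tendsto_fst
    have b2 : Tendsto (fun p : Cn n × Cn n => g p.2) (𝓝[Ω₁] a ×ˢ 𝓝[Ω₁] b) (𝓝 (G b)) :=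
      (hGlim b hbc).comp tendsto_snd
    have hev : ∀ᶠ p : Cn n × Cn n in 𝓝[Ω₁] a ×ˢ 𝓝[Ω₁] b, p.1 ∈ Ω₁ ∧ p.2 ∈ Ω₁ :=
      prod_mem_prod self_mem_nhdsWithin self_mem_nhdsWithin
    have z1 := (mem_frontier_iff_bdryDist_eq_zero hfr₁).1 ha
    have z2 := (mem_frontier_iff_bdryDist_eq_zero hfr₁).1 hb
    have z3 := (mem_frontier_iff_bdryDist_eq_zero hfr₂).1 ((hfrontier a hac).1 ha)
    have z4 := (mem_frontier_iff_bdryDist_eq_zero hfr₂).1 ((hfrontier b hbc).1 hb)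
    have r1 := (((a1.sub b1).norm.add (((hδc Ω₁).tendsto a).comp a1)).add
      (((hδc Ω₁).tendsto b).comp b1)).const_mul C₁
    have r2 := (((a2.sub b2).norm.add (((hδc Ω₂).tendsto _).comp a2)).add
      (((hδc Ω₂).tendsto _).comp b2)).const_mul C₂
    rw [z1, z2, add_zero, add_zero] at r1
    rw [z3, z4, add_zero, add_zero] at r2
    exact ⟨le_of_tendsto_of_tendsto ((a2.sub b2).norm.rpow_const (Or.inr hm.le)) r1
        (hev.mono fun p hp => hle₁ ⟨p.1, hp.1⟩ ⟨p.2, hp.2⟩),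
      le_of_tendsto_of_tendsto ((a1.sub b1).norm.rpow_const (Or.inr hm.le)) r2
        (hev.mono fun p hp => hle₂ ⟨p.1, hp.1⟩ ⟨p.2, hp.2⟩)⟩
  have hdich : ∀ a ∈ closure Ω₁, a ∈ Ω₁ ∨ a ∈ frontier Ω₁ := by
    intro a ha
    rw [h₁.isOpen.frontier_eq]
    by_cases haΩ : a ∈ Ω₁
    · exact Or.inl haΩ
    · exact Or.inr ⟨ha, haΩ⟩
  have hGΩ : ∀ a ∈ Ω₁, G a ∈ Ω₂ := fun a ha => by rw [hGg a ha]; exact hg ha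
  -- bijectivity
  have hGinj : InjOn G (closure Ω₁) := by
    intro a ha b hb hab
    rcases hdich a ha with ha' | ha' <;> rcases hdich b hb with hb' | hb'
    · rw [hGg a ha', hGg b hb'] at hab
      exact hginj ha' hb' hab
    · exact absurd (hab ▸ hGΩ a ha') (h₂.notMem_of_mem_frontier ((hfrontier b hb).1 hb'))
    · exact absurd (hab ▸ hGΩ b hb') (h₂.notMem_of_mem_frontier ((hfrontier a ha).1 ha'))
    · have h5 := (hbdry a ha' b hb').2
      rw [hab, sub_self, norm_zero, mul_zero] at h5
      have h6 : ‖a - b‖ = 0 := by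
        by_contra h7
        exact absurd h5 (not_le.2 (Real.rpow_pos_of_pos
          (lt_of_le_of_ne (norm_nonneg _) (Ne.symm h7)) m))
      exact sub_eq_zero.1 (norm_eq_zero.1 h6)
  have hK : IsCompact (closure Ω₁) := h₁.isBounded.isCompact_closure
  have hGK : IsClosed (G '' closure Ω₁) := (hK.image_of_continuousOn hGc).isClosed
  -- The image is open by invariance of domain. A limit of the image lying in `Ω₂` is `G a` for some
  -- `a` in the closure, and `a` cannot be a boundary point; so the image is also relatively closed
  -- in the connected set `Ω₂`.
  have hsurjΩ : Ω₂ ⊆ g '' Ω₁ := by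
    refine h₂.convex.isPreconnected.subset_of_closure_inter_subset
      (isOpen_image_of_continuousOn_injOn h₁.isOpen hgc hginj) ?_ ?_
    · obtain ⟨x, hx⟩ := h₁.nonempty
      exact ⟨g x, hg hx, mem_image_of_mem g hx⟩
    · rintro y ⟨hy, hyΩ⟩
      have hsub : closure (g '' Ω₁) ⊆ G '' closure Ω₁ := by
        refine closure_minimal ?_ hGK
        rintro _ ⟨x, hx, rfl⟩
        exact ⟨x, subset_closure hx, hGg x hx⟩
      obtain ⟨a, ha, rfl⟩ := hsub hy
      rcases hdich a ha with ha' | ha'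
      · exact ⟨a, ha', (hGg a ha').symm⟩
      · exact absurd hyΩ (h₂.notMem_of_mem_frontier ((hfrontier a ha).1 ha'))
  have hGsurj : closure Ω₂ ⊆ G '' closure Ω₁ := by
    refine closure_minimal (fun y hy => ?_) hGK
    obtain ⟨x, hx, rfl⟩ := hsurjΩ hy
    exact ⟨x, subset_closure hx, hGg x hx⟩
  let e : closure Ω₁ ≃ closure Ω₂ := Equiv.ofBijective (hGmaps.restrict G _ _)
    ⟨fun a b hab => Subtype.ext (hGinj a.2 b.2 (congrArg Subtype.val hab)), fun y => by
      obtain ⟨a, ha, hay⟩ := hGsurj y.2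
      exact ⟨⟨a, ha⟩, Subtype.ext hay⟩⟩
  have hec : Continuous e := hGc.mapsToRestrict hGmaps
  have : CompactSpace (closure Ω₁) := isCompact_iff_compactSpace.1 hK
  refine ⟨hec.homeoOfEquivCompactToT2, fun p => ⟨G p, (hfrontier p
    (frontier_subset_closure p.2)).1 p.2⟩, fun x => ?_, fun p => rfl, by positivity, ?_, ?_, ?_⟩
  · exact (hGg x x.2).trans (hgf x)
  · rw [div_lt_one hm]; exact h₁.one_lt
  · constructor
    · intro a b hab
      exact Subtype.ext (hGinj (frontier_subset_closure a.2) (frontier_subset_closure b.2)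
        (congrArg Subtype.val hab))
    · intro q
      obtain ⟨a, ha, haq⟩ := hGsurj (frontier_subset_closure q.2)
      exact ⟨⟨a, (hfrontier a ha).2 (haq ▸ q.2)⟩, Subtype.ext haq⟩
  · refine ⟨max 1 (max (C₁ ^ (1 / m)) C₂), le_max_left _ _, fun a b => ?_⟩
    obtain ⟨i1, i2⟩ := hbdry a a.2 b b.2
    have hΛ : 0 < max 1 (max (C₁ ^ (1 / m)) C₂) := lt_of_lt_of_le one_pos (le_max_left _ _)
    simp only [Subtype.dist_eq, dist_eq_norm, one_div_one_div]
    constructor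
    · rw [inv_mul_le_iff₀ hΛ]
      refine i2.trans (mul_le_mul_of_nonneg_right ?_ (norm_nonneg _))
      exact (le_max_right _ _).trans (le_max_right _ _)
    · calc ‖G a - G b‖ = (‖G a - G b‖ ^ m) ^ (1 / m) := by
            rw [← Real.rpow_mul (norm_nonneg _), mul_one_div_cancel hm.ne', Real.rpow_one]
        _ ≤ (C₁ * ‖(a : Cn n) - b‖) ^ (1 / m) :=
            Real.rpow_le_rpow (by positivity) i1 (by positivity)
        _ = C₁ ^ (1 / m) * ‖(a : Cn n) - b‖ ^ (1 / m) := Real.mul_rpow hC₁.le (norm_nonneg _)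
        _ ≤ _ := by
            refine mul_le_mul_of_nonneg_right ?_ (by positivity)
            exact (le_max_left _ _).trans (le_max_right _ _)

end BoundaryExtension
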